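/- Let $n,d_x,d_y,d_\gamma,N\in\mathbb N$, $a\le b$, $\alpha>0$ and $\epsilon,\delta\in(0,1)$. Let $\mathbf X\subset\mathbb R^n$ be a Borel set such that every polynomial in $(\mathbf x,y)$ of total degree at most $d_\gamma$ is Lebesgue integrable on $\mathbf X\times[a,b]$ (e.g. $\mathbf X$ bounded), let $f:\mathbb R^n\to\mathbb R$ be measurable with $f(\mathbf X)\subset[a,b]=:\mathbf Y$, and let $\mathbb P$ be a Borel probability measure on $\mathbf X$. The decision variables are $\theta=((h_k)_{k=1}^{d_y},\gamma)$, where $h_k\in\mathbb R[\mathbf x]$ has total degree at most $d_x$ and $\gamma\in\mathbb R[\mathbf x,y]$ has total degree at most $d_\gamma$; put $p(\mathbf x,y)=\sum_{k=1}^{d_y}h_k(\mathbf x)y^k$, and let $n_\theta$ be the total number of coefficients of $h_1,\dots,h_{d_y},\gamma$. Let $\Sigma_m[y]$ be the set of sums of squares of real univariate polynomials that have degree at most $m$, and let $d=\max(d_y,2)$. Given $\mathbf x_1,\dots,\mathbf x_N$ and $y_i=f(\mathbf x_i)$, the sample-based SOS program is to minimize $\int_{\mathbf X\times[a,b]}\gamma(\mathbf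 x,y)\,d\mathbf x\,dy$ over $\theta$ subject to, for $i=1,\dots,N$: $\gamma(\mathbf x_i,y_i)\ge 0$, and the polynomial $q_i(y)=p(\mathbf x_i,y)-p(\mathbf x_i,y_i)+\gamma(\mathbf x_i,y_i)-\alpha(y-y_i)^2$ is of the form $\sigma_{0}+\sigma_{1}(b-y)(y-a)$ with $\sigma_{0}\in\Sigma_{d}[y]$, $\sigma_{1}\in\Sigma_{d-2}[y]$ if $d$ is even, and of the form $\sigma_0(y-a)+\sigma_1(b-y)$ with $\sigma_0,\sigma_1\in\Sigma_{d-1}[y]$ if $d$ is odd. Ties between optimal solutions, if any, are broken by a fixed convex function $t$ of $\theta$ that does not depend on the sample: "the optimal solution" is the optimal $\theta$ with $t(\theta)<t(\theta')$ for every other optimal $\theta'$ (if the optimal solution is unique, $t$ plays no role). Suppose that $$\sum_{k=0}^{n_\theta-1}\binom Nk\epsilon^k(1-\epsilon)^{N-k}\le\delta\qquad(1)$$ or $$N\ge\frac1\epsilon\Big(n_\theta-1+\ln\frac1\delta+\sqrt{2(n_\theta-1)\ln\frac1\delta}\Big)\qquad(2)$$ holds; condition (2) implies (1). Then, with probability at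 least $1-\delta$ over $N$ i.i.d. samples $\mathbf x_1,\dots,\mathbf x_N$ drawn from $\mathbb P$, the following holds. If $(p,\gamma)$ is the optimal solution of the sample-based SOS program, $\gamma_{\max}=\sup_{\mathbf X\times[a,b]}\gamma$ is finite, and $\hat f$ is any measurable function with $\hat f(\mathbf x)\in\operatorname{Argmin}_{y\in\mathbf Y}p(\mathbf x,y)$ for all $\mathbf x\in\mathbf X$, then $$\mathbb P\Big(\big\{\mathbf x\in\mathbf X:|\hat f(\mathbf x)-f(\mathbf x)|\le\sqrt{\gamma_{\max}/\alpha}\big\}\Big)>1-\epsilon .$$ -/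

import Mathlib

namespace PolyArgmin

noncomputable section

/-- The decision variables of the program: polynomials `h₁, …, h_{dy} ∈ ℝ[x]` of total degree at
most `dx` (the component `k : Fin dy` is `h_{k+1}`), and a polynomial `γ ∈ ℝ[x, y]` of total degree
at most `dg`. The variables of `γ` are `Sum.inl j` for `x_j` and `Sum.inr ()` for `y`. -/
abbrev Decision (n dx dy dg : ℕ) : Type :=
  (Fin dy → MvPolynomial.restrictTotalDegree (Fin n) ℝ dx) ×
    MvPolynomial.restrictTotalDegree (Fin n ⊕ Unit) ℝ dg

/-- The number `n_θ` of (scalar) decision variables, i.e. of coefficients of `h₁, …, h_{dy}, γ`. -/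
def numVars (n dx dy dg : ℕ) : ℕ := Module.finrank ℝ (Decision n dx dy dg)

/-- Value at `(x, y)` of a polynomial in the variables `(x, y) ∈ ℝⁿ × ℝ`. -/
def evalXY {n : ℕ} (g : MvPolynomial (Fin n ⊕ Unit) ℝ) (x : Fin n → ℝ) (y : ℝ) : ℝ :=
  MvPolynomial.eval (Sum.elim x (fun _ => y)) g

variable {n dx dy dg : ℕ}

/-- The value `γ(x, y)`. -/
def gammaVal (θ : Decision n dx dy dg) (x : Fin n → ℝ) (y : ℝ) : ℝ :=
  evalXY (θ.2 : MvPolynomial (Fin n ⊕ Unit) ℝ) x y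

/-- For fixed `x`, the univariate polynomial `p(x, ·) = ∑_{k=1}^{dy} h_k(x) y^k` in `y`. -/
def pPoly (θ : Decision n dx dy dg) (x : Fin n → ℝ) : Polynomial ℝ :=
  ∑ k : Fin dy, Polynomial.C (MvPolynomial.eval x (θ.1 k : MvPolynomial (Fin n) ℝ)) *
    Polynomial.X ^ ((k : ℕ) + 1)

/-- The value `p(x, y)`. -/
def pVal (θ : Decision n dx dy dg) (x : Fin n → ℝ) (y : ℝ) : ℝ := (pPoly θ x).eval y

/-- `Σ_d[y]`: the univariate sums of squares of degree at most `d`. -/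
def sosCone (d : ℕ) : Set (Polynomial ℝ) := {σ | IsSumSq σ ∧ σ.natDegree ≤ d}

/-- The sum-of-squares certificate of nonnegativity on `[a, b]` of a univariate polynomial of
degree at most `d` (used for `d ≥ 2`). -/
def SOSCertificate (a b : ℝ) (d : ℕ) (q : Polynomial ℝ) : Prop :=
  (Even d ∧ ∃ σ₀ ∈ sosCone d, ∃ σ₁ ∈ sosCone (d - 2),
    q = σ₀ + σ₁ * ((Polynomial.C b - Polynomial.X) * (Polynomial.X - Polynomial.C a))) ∨
  (Odd d ∧ ∃ σ₀ ∈ sosCone (d - 1), ∃ σ₁ ∈ sosCone (d - 1),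
    q = σ₀ * (Polynomial.X - Polynomial.C a) + σ₁ * (Polynomial.C b - Polynomial.X))

/-- For a data point `(x₀, y₀)`, the polynomial
`p(x₀, y) - p(x₀, y₀) + γ(x₀, y₀) - α (y - y₀)²` in `y`. -/
def slackPoly (α : ℝ) (θ : Decision n dx dy dg) (x₀ : Fin n → ℝ) (y₀ : ℝ) : Polynomial ℝ :=
  pPoly θ x₀ - Polynomial.C (pVal θ x₀ y₀) + Polynomial.C (gammaVal θ x₀ y₀)
    - Polynomial.C α * (Polynomial.X - Polynomial.C y₀) ^ 2

/-- Feasibility in the SOS program with data points `(x_i, f(x_i))`. The degree in `y` of the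
certified polynomial is at most `max dy 2`, because of the term `α (y - y_i)²`. -/
def Feasible (a b α : ℝ) (f : (Fin n → ℝ) → ℝ) {N : ℕ} (s : Fin N → Fin n → ℝ)
    (θ : Decision n dx dy dg) : Prop :=
  ∀ i : Fin N, SOSCertificate a b (max dy 2) (slackPoly α θ (s i) (f (s i))) ∧
    0 ≤ gammaVal θ (s i) (f (s i))

/-- The objective `∫_{X × [a, b]} γ(x, y) dx dy`. -/
def objective (X : Set (Fin n → ℝ)) (a b : ℝ) (θ : Decision n dx dy dg) : ℝ :=
  ∫ z : (Fin n → ℝ) × ℝ in X ×ˢ Set.Icc a b, gammaVal θ z.1 z.2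

/-- Optimal solutions of the SOS program with data points `(x_i, f(x_i))`. -/
def IsOptimal (X : Set (Fin n → ℝ)) (a b α : ℝ) (f : (Fin n → ℝ) → ℝ) {N : ℕ}
    (s : Fin N → Fin n → ℝ) (θ : Decision n dx dy dg) : Prop :=
  Feasible a b α f s θ ∧
    ∀ θ' : Decision n dx dy dg, Feasible a b α f s θ' → objective X a b θ ≤ objective X a b θ'

/-- `θ` is the optimal solution singled out by the tie-break function `t`: it is optimal, and `t`
is strictly larger at every other optimal solution. (If the optimal solution is unique, it is
singled out by every `t`.) -/
def IsSelectedOptimal (t : Decision n dx dy dg → ℝ) (X : Set (Fin n → ℝ)) (a b α : ℝ)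
    (f : (Fin n → ℝ) → ℝ) {N : ℕ} (s : Fin N → Fin n → ℝ) (θ : Decision n dx dy dg) : Prop :=
  IsOptimal X a b α f s θ ∧
    ∀ θ' : Decision n dx dy dg, IsOptimal X a b α f s θ' → θ' ≠ θ → t θ < t θ'

/-- `fhat` is a measurable selection of `x ↦ Argmin_{y ∈ [a, b]} p(x, y)` on `X`. -/
def IsArgminSelection (X : Set (Fin n → ℝ)) (a b : ℝ) (θ : Decision n dx dy dg)
    (fhat : (Fin n → ℝ) → ℝ) : Prop :=
  Measurable fhat ∧
    ∀ x ∈ X, fhat x ∈ Set.Icc a b ∧ ∀ y ∈ Set.Icc a b, pVal θ x (fhat x) ≤ pVal θ x y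

/-- The binomial tail condition `∑_{k=0}^{m-1} (N choose k) ε^k (1-ε)^{N-k} ≤ δ`. -/
def BinomialCondition (m N : ℕ) (ε δ : ℝ) : Prop :=
  ∑ k ∈ Finset.range m, (N.choose k : ℝ) * ε ^ k * (1 - ε) ^ (N - k) ≤ δ

/-- The explicit condition `N ≥ (1/ε) (m - 1 + ln(1/δ) + √(2 (m - 1) ln(1/δ)))`. -/
def ExplicitCondition (m N : ℕ) (ε δ : ℝ) : Prop :=
  1 / ε * ((m : ℝ) - 1 + Real.log (1 / δ) + Real.sqrt (2 * ((m : ℝ) - 1) * Real.log (1 / δ)))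
    ≤ (N : ℝ)

end

end PolyArgmin

namespace PolyArgmin

/-! ### Markov–Lukács certificates on an interval. -/

section Lukacs

open Polynomial

/-! The result is the scenario theorem of convex optimization applied to the SOS program. For `a <
b`, the certificate for `q_i` exists exactly when `q_i ≥ 0` on `[a, b]` (`sosCertificate_iff`). Each
sample thus contributes one scalar constraint `minSlack ≥ 0`, concave in `θ`. Where it holds at a
point `x` of `X`, minimality of `p(x, ·)` at `fhat x` gives `α (fhat x - f x)² ≤ γ(x, f x) ≤ γmax`.
It remains to bound the probability that the optimal solution violates the constraint at a fresh
point.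

In a nondegenerate program with `m` variables, Helly's theorem yields `m` samples that determine the
solution, and a tie-break by random tags makes the choice unique: almost surely exactly one
`m`-subset dominates all other samples (`existsUnique_dominating`). Let `V` be the probability that
a fresh sample is dominated by `m` given ones. Each of the `(m+k).choose m` subsets of `m + k`
samples dominates with probability `E[V^k]`, and these events partition the sample space up to a
null set, so `E[V^k] = 1 / (m+k).choose m`. These moments force `1 - V` to have the Beta(m, 1) law.
Summing over `m`-subsets of `N` samples the probability that the subset dominates and `1 - V > ε`
gives precisely the binomial tail (`measureReal_violation_le`).

The given program need be neither nondegenerate nor strictly convex. It is therefore perturbed: the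
objective becomes `c + l exp(t) + l²‖·‖²`, and each constraint is relaxed by `l²` times an
independent uniform variable, which also serves as the tag. As `l → 0`, the perturbed solutions
converge to the one selected by `t` (`tendsto_opt_regularized`), and lower semicontinuity of
measures carries the bound to the limit (`exists_measurableSet_violation_lt`). The explicit sample
size follows from Chernoff's bound. -/

lemma zero_mem_sosCone (d : ℕ) : (0 : ℝ[X]) ∈ sosCone d := ⟨IsSumSq.zero, by simp⟩

lemma add_mem_sosCone {d : ℕ} {p q : ℝ[X]} (hp : p ∈ sosCone d) (hq : q ∈ sosCone d) :
    p + q ∈ sosCone d :=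
  ⟨hp.1.add hq.1, natDegree_add_le_of_degree_le hp.2 hq.2⟩

lemma mul_mem_sosCone {d e k : ℕ} {p q : ℝ[X]} (hp : p ∈ sosCone d) (hq : q ∈ sosCone e)
    (hk : d + e ≤ k) : p * q ∈ sosCone k :=
  ⟨hp.1.mul hq.1, (natDegree_mul_le_of_le hp.2 hq.2).trans hk⟩

lemma sq_mem_sosCone {k : ℕ} (p : ℝ[X]) (hk : 2 * p.natDegree ≤ k) : p * p ∈ sosCone k :=
  ⟨IsSumSq.mul_self p, natDegree_mul_le.trans (by omega)⟩

lemma C_mem_sosCone {c : ℝ} (hc : 0 ≤ c) (d : ℕ) : (C c : ℝ[X]) ∈ sosCone d := by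
  refine ⟨?_, by simp⟩
  rw [← Real.mul_self_sqrt hc, C_mul]
  exact IsSumSq.mul_self _

lemma eval_nonneg_of_mem_sosCone {d : ℕ} {p : ℝ[X]} (hp : p ∈ sosCone d) (y : ℝ) :
    0 ≤ p.eval y := by
  obtain ⟨h, -⟩ := hp
  induction h with
  | zero => simp
  | sq_add q _ ih =>
    rw [eval_add, eval_mul]
    exact add_nonneg (mul_self_nonneg _) ih

/-- The product of certificates, for the parities used in the factorisation argument. -/
lemma SOSCertificate.mul {a b : ℝ} {d e : ℕ} {p q : ℝ[X]} (hd : Odd d ∨ 2 ≤ d) (he : Odd e ∨ 2 ≤ e)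
    (hp : SOSCertificate a b d p) (hq : SOSCertificate a b e q) :
    SOSCertificate a b (d + e) (p * q) := by
  -- With `u = X - a` and `v = b - X`, even certificates read `σ₀ + σ₁uv` and odd ones `σ₀u + σ₁v`.
  -- When a product is expanded, surplus factors occur only as `u²` or `v²` and are absorbed into
  -- the sums of squares.
  have hu : ((X - C a) * (X - C a) : ℝ[X]) ∈ sosCone 2 := sq_mem_sosCone _ (by simp)
  have hv : ((C b - X) * (C b - X) : ℝ[X]) ∈ sosCone 2 := by
    refine sq_mem_sosCone _ ?_
    rw [← neg_sub, natDegree_neg]; simp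
  rcases hp with ⟨hde, s0, hs0, s1, hs1, rfl⟩ | ⟨hdo, s0, hs0, s1, hs1, rfl⟩ <;>
  rcases hq with ⟨hee, r0, hr0, r1, hr1, rfl⟩ | ⟨heo, r0, hr0, r1, hr1, rfl⟩
  · have hd2 : 2 ≤ d := hd.resolve_left (by simpa using hde)
    have he2 : 2 ≤ e := he.resolve_left (by simpa using hee)
    refine Or.inl ⟨hde.add hee, s0 * r0 + (s1 * r1) * (((X - C a) * (X - C a)) *
      ((C b - X) * (C b - X))), add_mem_sosCone (mul_mem_sosCone hs0 hr0 le_rfl)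
      (mul_mem_sosCone (mul_mem_sosCone hs1 hr1 le_rfl) (mul_mem_sosCone hu hv le_rfl) (by omega)),
      s0 * r1 + s1 * r0, add_mem_sosCone (mul_mem_sosCone hs0 hr1 (by omega))
      (mul_mem_sosCone hs1 hr0 (by omega)), by ring⟩
  · have hd2 : 2 ≤ d := hd.resolve_left (by simpa using hde)
    have := heo.pos
    refine Or.inr ⟨hde.add_odd heo, s0 * r0 + s1 * r1 * ((C b - X) * (C b - X)),
      add_mem_sosCone (mul_mem_sosCone hs0 hr0 (by omega))
      (mul_mem_sosCone (mul_mem_sosCone hs1 hr1 le_rfl) hv (by omega)),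
      s0 * r1 + s1 * r0 * ((X - C a) * (X - C a)),
      add_mem_sosCone (mul_mem_sosCone hs0 hr1 (by omega))
      (mul_mem_sosCone (mul_mem_sosCone hs1 hr0 le_rfl) hu (by omega)), by ring⟩
  · have he2 : 2 ≤ e := he.resolve_left (by simpa using hee)
    have := hdo.pos
    refine Or.inr ⟨hdo.add_even hee, s0 * r0 + s1 * r1 * ((C b - X) * (C b - X)),
      add_mem_sosCone (mul_mem_sosCone hs0 hr0 (by omega))
      (mul_mem_sosCone (mul_mem_sosCone hs1 hr1 le_rfl) hv (by omega)),
      s1 * r0 + s0 * r1 * ((X - C a) * (X - C a)),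
      add_mem_sosCone (mul_mem_sosCone hs1 hr0 (by omega))
      (mul_mem_sosCone (mul_mem_sosCone hs0 hr1 le_rfl) hu (by omega)), by ring⟩
  · have := hdo.pos
    have := heo.pos
    refine Or.inl ⟨hdo.add_odd heo, s0 * r0 * ((X - C a) * (X - C a)) +
      s1 * r1 * ((C b - X) * (C b - X)), add_mem_sosCone
      (mul_mem_sosCone (mul_mem_sosCone hs0 hr0 le_rfl) hu (by omega))
      (mul_mem_sosCone (mul_mem_sosCone hs1 hr1 le_rfl) hv (by omega)),
      s0 * r1 + s1 * r0, add_mem_sosCone (mul_mem_sosCone hs0 hr1 (by omega))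
      (mul_mem_sosCone hs1 hr0 (by omega)), by ring⟩

lemma sosCertificate_linear {a b l m : ℝ} (hl : 0 ≤ l) (hm : 0 ≤ m) :
    SOSCertificate a b 1 (C l * (X - C a) + C m * (C b - X)) :=
  Or.inr ⟨odd_one, _, C_mem_sosCone hl 0, _, C_mem_sosCone hm 0, rfl⟩

lemma sosCertificate_of_mem_sosCone {a b : ℝ} {p : ℝ[X]} (hp : p ∈ sosCone 2) :
    SOSCertificate a b 2 p :=
  Or.inl ⟨even_two, p, hp, 0, zero_mem_sosCone _, by simp⟩

/-- Multiplication by `1 = ((X - a) + (b - X)) / (b - a)`, which is certified in degree 1, switches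
the parity. -/
lemma SOSCertificate.succ {a b : ℝ} (hab : a < b) {d : ℕ} (hd : Odd d ∨ 2 ≤ d) {p : ℝ[X]}
    (hp : SOSCertificate a b d p) : SOSCertificate a b (d + 1) p := by
  have hba : 0 < b - a := sub_pos.2 hab
  have h := hp.mul hd (Or.inl odd_one)
    (sosCertificate_linear (a := a) (b := b) (inv_nonneg.2 hba.le) (inv_nonneg.2 hba.le))
  have h1 : (C (b - a)⁻¹ * (X - C a) + C (b - a)⁻¹ * (C b - X) : ℝ[X]) = 1 := by
    rw [← mul_add, show (X - C a + (C b - X) : ℝ[X]) = C (b - a) by rw [C_sub]; ring, ← C_mul,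
      inv_mul_cancel₀ hba.ne', C_1]
  rwa [h1, mul_one] at h

lemma SOSCertificate.mono {a b : ℝ} (hab : a < b) {d e : ℕ} (hd : Odd d ∨ 2 ≤ d) (hde : d ≤ e)
    {p : ℝ[X]} (hp : SOSCertificate a b d p) : SOSCertificate a b e p := by
  have hd1 : 1 ≤ d := hd.elim (fun h => h.pos) (by omega)
  induction e, hde using Nat.le_induction with
  | base => exact hp
  | succ k hk ih =>
    refine ih.succ hab ?_
    rcases Nat.lt_or_ge k 2 with h | h
    · left; rw [show k = 1 by omega]; exact odd_one
    · exact Or.inr h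

/-- Dividing `q ≥ 0` by a factor vanishing only at `r` loses the information at `r`; continuity
restores it. -/
lemma nonneg_Icc_of_punctured {q : ℝ[X]} {a b : ℝ} (hab : a < b) (r : ℝ)
    (h : ∀ y ∈ Set.Icc a b, y ≠ r → 0 ≤ q.eval y) : ∀ y ∈ Set.Icc a b, 0 ≤ q.eval y := by
  have hcl : Set.Icc a b ⊆ closure (Set.Ioo a b \ {r}) := by
    rw [← closure_Ioo hab.ne]
    exact closure_minimal ((dense_compl_singleton r).open_subset_closure_inter isOpen_Ioo)
      isClosed_closure
  intro y hy
  have hc : IsClosed {y | 0 ≤ q.eval y} := isClosed_le continuous_const q.continuous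
  exact hc.closure_subset_iff.2 (fun z hz => h z (Set.Ioo_subset_Icc_self hz.1) hz.2) (hcl hy)

/-- The Markov-Lukács theorem: a polynomial which is nonnegative on `[a, b]` has a certificate. -/
theorem sosCertificate_of_nonneg {a b : ℝ} (hab : a < b) (k : ℕ) :
    ∀ q : ℝ[X], q.natDegree = k → (∀ y ∈ Set.Icc a b, 0 ≤ q.eval y) →
      SOSCertificate a b (max k 1) q := by
  have hba : 0 < b - a := sub_pos.2 hab
  induction k using Nat.strong_induction_on with
  | _ k ih =>
  intro q hq hnn
  have hpar : ∀ j : ℕ, Odd (max j 1) ∨ 2 ≤ max j 1 := fun j => by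
    rcases Nat.lt_or_ge j 2 with h | h
    · left; rw [show max j 1 = 1 by omega]; exact odd_one
    · right; omega
  -- A linear function is the interpolation of its values at `a` and `b`, and these are the
  -- nonnegative coefficients.
  have hlin : ∀ l m : ℝ, 0 ≤ l * a + m → 0 ≤ l * b + m → SOSCertificate a b 1 (C l * X + C m) := by
    intro l m h1 h2
    have := sosCertificate_linear (a := a) (b := b) (l := (l * b + m) / (b - a))
      (m := (l * a + m) / (b - a)) (by positivity) (by positivity)
    convert this using 1
    have e1 : l = (l * b + m) / (b - a) - (l * a + m) / (b - a) := by field_simp; ring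
    have e2 : m = (l * a + m) / (b - a) * b - (l * b + m) / (b - a) * a := by field_simp; ring
    generalize (l * b + m) / (b - a) = u at *
    generalize (l * a + m) / (b - a) = v at *
    rw [e1, e2]
    simp only [C_sub, C_mul]
    ring
  rcases Nat.eq_zero_or_pos k with hk | hk
  · rw [hk] at hq ⊢
    rw [eq_C_of_natDegree_eq_zero hq] at hnn ⊢
    have := hnn a ⟨le_rfl, hab.le⟩
    rw [eval_C] at this
    simpa using hlin 0 (q.coeff 0) (by simpa using this) (by simpa using this)
  have hq0 : q ≠ 0 := by rintro rfl; simp at hq; omega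
  -- Split off a certified factor of exact degree `j` and apply induction to the cofactor. A
  -- constant cofactor is treated directly, since its inductive certificate of degree 1 would
  -- overshoot the degree.
  have step : ∀ (j : ℕ) (p g : ℝ[X]), 1 ≤ j → q = p * g → p.natDegree = j →
      (Odd j ∨ 2 ≤ j) → SOSCertificate a b j p → (∀ y ∈ Set.Icc a b, 0 ≤ g.eval y) →
      SOSCertificate a b (max k 1) q := by
    intro j p g hj hpg hp hj' hpc hg
    have hp0 : p ≠ 0 := by rintro rfl; simp at hp; omega
    have hg0 : g ≠ 0 := by rintro rfl; simp at hpg; exact hq0 hpg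
    have hdeg : k = j + g.natDegree := by rw [← hq, hpg, natDegree_mul hp0 hg0, hp]
    rcases Nat.eq_zero_or_pos g.natDegree with h0 | h0
    · rw [eq_C_of_natDegree_eq_zero h0] at hg hpg
      have hc := hg a ⟨le_rfl, hab.le⟩
      rw [eval_C] at hc
      rw [show max k 1 = j by omega, hpg]
      have hs := C_mem_sosCone hc 0
      rcases hpc with ⟨h1, s0, hs0, s1, hs1, rfl⟩ | ⟨h1, s0, hs0, s1, hs1, rfl⟩
      · exact Or.inl ⟨h1, _, mul_mem_sosCone hs0 hs le_rfl, _, mul_mem_sosCone hs1 hs le_rfl,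
          by ring⟩
      · exact Or.inr ⟨h1, _, mul_mem_sosCone hs0 hs le_rfl, _, mul_mem_sosCone hs1 hs le_rfl,
          by ring⟩
    · have := hpc.mul hj' (hpar _) (ih g.natDegree (by omega) g rfl hg)
      rw [hpg]
      rwa [show j + max g.natDegree 1 = max k 1 by omega] at this
  by_cases hr : ∃ r, q.IsRoot r
  · obtain ⟨r, hr⟩ := hr
    obtain ⟨g, hg⟩ := dvd_iff_isRoot.2 hr
    have hgv : ∀ y, q.eval y = (y - r) * g.eval y := fun y => by rw [hg]; simp
    rcases le_or_gt r a with hra | hra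
    · refine step 1 (X - C r) g le_rfl hg (by simp) (Or.inl odd_one) ?_
        (nonneg_Icc_of_punctured hab r fun y hy hyr => ?_)
      · simpa [sub_eq_add_neg] using hlin 1 (-r) (by linarith) (by linarith)
      · have h1 := hnn y hy
        rw [hgv] at h1
        have : 0 < y - r := sub_pos.2 (lt_of_le_of_ne (hra.trans hy.1) (Ne.symm hyr))
        exact nonneg_of_mul_nonneg_right h1 this
    rcases le_or_gt b r with hrb | hrb
    · refine step 1 (C r - X) (-g) le_rfl (by rw [hg]; ring) ?_ (Or.inl odd_one) ?_
        (nonneg_Icc_of_punctured hab r fun y hy hyr => ?_)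
      · rw [← neg_sub, natDegree_neg]; simp
      · have := hlin (-1) r (by linarith) (by linarith)
        convert this using 1
        simp; ring
      · have h1 := hnn y hy
        rw [hgv] at h1
        have : 0 < r - y := sub_pos.2 (lt_of_le_of_ne (hy.2.trans hrb) hyr)
        rw [eval_neg]
        exact nonneg_of_mul_nonneg_right (by linarith) this
    -- An interior root is at least double, as `q` would otherwise change sign at `r`.
    · have hgr : g.IsRoot r := by
        have hcont : ContinuousAt (fun y => g.eval y) r := g.continuous.continuousAt
        refine le_antisymm ?_ ?_
        · refine le_of_tendsto (hcont.tendsto.mono_left (nhdsWithin_le_nhds (s := Set.Iio r))) ?_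
          filter_upwards [self_mem_nhdsWithin,
            nhdsWithin_le_nhds (Icc_mem_nhds hra hrb)] with y hy hy'
          have h1 := hnn y hy'
          rw [hgv] at h1
          have : 0 < r - y := sub_pos.2 hy
          have := nonneg_of_mul_nonneg_right (by linarith : 0 ≤ (r - y) * (- g.eval y)) this
          linarith
        · refine ge_of_tendsto (hcont.tendsto.mono_left (nhdsWithin_le_nhds (s := Set.Ioi r))) ?_
          filter_upwards [self_mem_nhdsWithin,
            nhdsWithin_le_nhds (Icc_mem_nhds hra hrb)] with y hy hy'
          have h1 := hnn y hy'
          rw [hgv] at h1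
          exact nonneg_of_mul_nonneg_right h1 (sub_pos.2 hy)
      obtain ⟨h, hh⟩ := dvd_iff_isRoot.2 hgr
      refine step 2 ((X - C r) * (X - C r)) h (by norm_num) (by rw [hg, hh]; ring) ?_
        (Or.inr le_rfl) (sosCertificate_of_mem_sosCone (sq_mem_sosCone _ (by simp)))
        (nonneg_Icc_of_punctured hab r fun y hy hyr => ?_)
      · rw [natDegree_mul (X_sub_C_ne_zero r) (X_sub_C_ne_zero r)]; simp
      · have h1 := hnn y hy
        rw [hgv, hh] at h1
        have h2 : 0 < (y - r) * (y - r) := mul_self_pos.2 (sub_ne_zero.2 hyr)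
        refine nonneg_of_mul_nonneg_right (a := (y - r) * (y - r)) ?_ h2
        simpa [mul_assoc] using h1
  -- Without real roots, a conjugate pair gives the factor `(X - Re z)² + (Im z)²`.
  · obtain ⟨z, hz⟩ := IsAlgClosed.exists_aeval_eq_zero ℂ q
      (by rw [degree_eq_natDegree hq0, hq]; exact_mod_cast hk.ne')
    have hzim : z.im ≠ 0 := by
      intro h0
      refine hr ⟨z.re, ?_⟩
      have hz' : z = algebraMap ℝ ℂ z.re := by
        apply Complex.ext <;> simp [h0]
      rw [hz', aeval_algebraMap_apply] at hz
      simpa using hz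
    obtain ⟨g, hg⟩ := q.quadratic_dvd_of_aeval_eq_zero_im_ne_zero hz hzim
    have hsq : (X ^ 2 - C (2 * z.re) * X + C (‖z‖ ^ 2) : ℝ[X]) =
        (X - C z.re) * (X - C z.re) + C z.im * C z.im := by
      rw [← Complex.normSq_eq_norm_sq, Complex.normSq_apply]
      simp only [C_add, C_mul]
      have : (C 2 : ℝ[X]) = 2 := rfl
      rw [this]; ring
    refine step 2 _ g (by norm_num) hg ?_ (Or.inr le_rfl) (sosCertificate_of_mem_sosCone ?_) ?_
    · compute_degree!
    · rw [hsq]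
      exact add_mem_sosCone (sq_mem_sosCone _ (by simp)) (sq_mem_sosCone _ (by simp))
    · intro y hy
      have h1 := hnn y hy
      rw [hg, eval_mul, hsq] at h1
      refine nonneg_of_mul_nonneg_right h1 ?_
      simp only [eval_add, eval_mul, eval_sub, eval_X, eval_C]
      have := mul_self_pos.2 hzim
      have := mul_self_nonneg (y - z.re)
      linarith

theorem sosCertificate_iff {a b : ℝ} (hab : a < b) {d : ℕ} (hd : 2 ≤ d) {q : ℝ[X]}
    (hq : q.natDegree ≤ d) :
    SOSCertificate a b d q ↔ ∀ y ∈ Set.Icc a b, 0 ≤ q.eval y := by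
  constructor
  · rintro (⟨-, s0, hs0, s1, hs1, rfl⟩ | ⟨-, s0, hs0, s1, hs1, rfl⟩) y hy
    · have h0 := eval_nonneg_of_mem_sosCone hs0 y
      have h1 := eval_nonneg_of_mem_sosCone hs1 y
      have h2 := sub_nonneg.2 hy.1
      have h3 := sub_nonneg.2 hy.2
      simp only [eval_add, eval_mul, eval_sub, eval_C, eval_X]
      positivity
    · have h0 := eval_nonneg_of_mem_sosCone hs0 y
      have h1 := eval_nonneg_of_mem_sosCone hs1 y
      have h2 := sub_nonneg.2 hy.1
      have h3 := sub_nonneg.2 hy.2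
      simp only [eval_add, eval_mul, eval_sub, eval_C, eval_X]
      positivity
  · intro h
    refine (sosCertificate_of_nonneg hab _ q rfl h).mono hab ?_ (by omega)
    rcases Nat.lt_or_ge q.natDegree 2 with h | h
    · left; rw [show max q.natDegree 1 = 1 by omega]; exact odd_one
    · right; omega

end Lukacs

/-! ### The explicit sample size from Chernoff's bound. -/

section Chernoff

/-- Chernoff's bound for the lower tail of the binomial distribution. -/
lemma sum_binomial_le {k N : ℕ} {ε u : ℝ} (hε : ε ∈ Set.Ioo (0 : ℝ) 1) (hu : 1 ≤ u) :
    ∑ i ∈ Finset.range (k + 1), (N.choose i : ℝ) * ε ^ i * (1 - ε) ^ (N - i) ≤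
      u ^ k * (ε / u + (1 - ε)) ^ N := by
  have h1 : 0 ≤ 1 - ε := by linarith [hε.2]
  have h0 := hε.1.le
  have hu0 : 0 < u := by linarith
  calc _ ≤ ∑ i ∈ Finset.range (k + 1),
        u ^ k * ((ε / u) ^ i * (1 - ε) ^ (N - i) * (N.choose i : ℝ)) := by
        refine Finset.sum_le_sum fun i hi => ?_
        have hi' : i ≤ k := Nat.lt_succ_iff.1 (Finset.mem_range.1 hi)
        -- Exponential tilting: `u^(k-i) ≥ 1` for `i ≤ k`. The tilted terms are afterwards completed
        -- to the full binomial expansion.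
        have : ε ^ i ≤ u ^ k * (ε / u) ^ i := by
          rw [div_pow, ← mul_div_assoc, le_div_iff₀ (by positivity), mul_comm]
          gcongr
        calc _ = (N.choose i : ℝ) * (1 - ε) ^ (N - i) * ε ^ i := by ring
          _ ≤ (N.choose i : ℝ) * (1 - ε) ^ (N - i) * (u ^ k * (ε / u) ^ i) := by gcongr
          _ = _ := by ring
    _ ≤ _ := by
        rw [← Finset.mul_sum, add_pow]
        refine mul_le_mul_of_nonneg_left ?_ (by positivity)
        rcases le_total k N with h | h
        · exact Finset.sum_le_sum_of_subset_of_nonneg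
            (Finset.range_subset_range.2 (by omega)) fun i _ _ => by positivity
        · rw [← Finset.sum_subset (Finset.range_subset_range.2 (by omega : N + 1 ≤ k + 1))]
          intro i _ hi
          rw [Nat.choose_eq_zero_of_lt (by simpa using hi)]
          simp

/-- With `k = m - 1 > 0`, Chernoff's bound at `u = Nε/k` is `exp(k (log u - u + 1))`. For `L =
ln(1/δ)` and `s = √(2L/k)`, the hypothesis says `u ≥ v = 1 + s + s²/2`. Since `v ≤ exp s` and `log u
- u` decreases for `u ≥ 1`, the exponent is at most `-k s²/2 = -L`. -/
theorem binomialCondition_of_explicitCondition {m N : ℕ} {ε δ : ℝ} (hm : 1 ≤ m)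
    (hε : ε ∈ Set.Ioo (0 : ℝ) 1) (hδ : δ ∈ Set.Ioo (0 : ℝ) 1)
    (h : ExplicitCondition m N ε δ) : BinomialCondition m N ε δ := by
  obtain ⟨k, rfl⟩ : ∃ k, m = k + 1 := ⟨m - 1, by omega⟩
  have hε0 := hε.1
  unfold ExplicitCondition at h
  set L := Real.log (1 / δ) with hL
  have hL0 : 0 < L := Real.log_pos (by rw [lt_div_iff₀ hδ.1]; linarith [hδ.2])
  have hδL : δ = Real.exp (-L) := by
    rw [hL, one_div, Real.log_inv, neg_neg, Real.exp_log hδ.1]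
  rw [one_div_mul_eq_div, div_le_iff₀ hε.1] at h
  push_cast at h
  rw [add_sub_cancel_right] at h
  unfold BinomialCondition
  have base : ∀ u : ℝ, 1 ≤ u → (ε / u + (1 - ε)) ^ N ≤ Real.exp (-(N * ε) * (1 - 1 / u)) := by
    intro u hu
    have hu0 : 0 < u := by linarith
    have h2 : 0 ≤ 1 - ε := by linarith [hε.2]
    have : ε / u + (1 - ε) ≤ Real.exp (-ε * (1 - 1 / u)) := by
      have := Real.add_one_le_exp (-ε * (1 - 1 / u))
      refine le_trans (le_of_eq ?_) this
      field_simp; ring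
    calc _ ≤ (Real.exp (-ε * (1 - 1 / u))) ^ N := by gcongr
      _ = _ := by rw [← Real.exp_nat_mul]; congr 1; ring
  rcases Nat.eq_zero_or_pos k with rfl | hk
  · simp only [CharP.cast_eq_zero, zero_add, mul_zero, zero_mul, Real.sqrt_zero, add_zero] at h
    simp only [zero_add, Finset.range_one, Finset.sum_singleton, Nat.choose_zero_right,
      Nat.cast_one, pow_zero, one_mul, Nat.sub_zero]
    rw [hδL]
    calc (1 - ε) ^ N ≤ (Real.exp (-ε)) ^ N := by
          have := Real.add_one_le_exp (-ε)
          have h2 : 0 ≤ 1 - ε := by linarith [hε.2]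
          gcongr; linarith
      _ = Real.exp (-(N * ε)) := by rw [← Real.exp_nat_mul]; congr 1; ring
      _ ≤ _ := Real.exp_le_exp.2 (by linarith)
  have hk0 : (0 : ℝ) < k := by exact_mod_cast hk
  set u := N * ε / k with hu
  set s := Real.sqrt (2 * L / k) with hs
  have hs0 : 0 ≤ s := Real.sqrt_nonneg _
  have hs2 : s ^ 2 = 2 * L / k := Real.sq_sqrt (by positivity)
  have hsk : Real.sqrt (2 * k * L) = k * s := by
    rw [hs, show 2 * (k : ℝ) * L = k ^ 2 * (2 * L / k) by field_simp, Real.sqrt_mul (by positivity),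
      Real.sqrt_sq hk0.le]
  have hus : 1 + s + s ^ 2 / 2 ≤ u := by
    rw [hu, le_div_iff₀ hk0, hs2]
    rw [hsk] at h
    refine le_trans (le_of_eq ?_) h
    field_simp
    ring
  have hu1 : 1 ≤ u := by nlinarith
  have hu0 : 0 < u := by linarith
  refine (sum_binomial_le hε hu1).trans ?_
  calc _ ≤ u ^ k * Real.exp (-(N * ε) * (1 - 1 / u)) := by gcongr; exact base u hu1
    _ = Real.exp (k * (Real.log u - u + 1)) := by
        rw [← Real.exp_log (pow_pos hu0 k), ← Real.exp_add, Real.log_pow,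
          show (N : ℝ) * ε = k * u by rw [hu]; field_simp]
        congr 1
        field_simp
        ring
    _ ≤ δ := by
        rw [hδL]
        refine Real.exp_le_exp.2 ?_
        set v := 1 + s + s ^ 2 / 2 with hv
        have hv1 : 1 ≤ v := by nlinarith
        have hv0 : 0 < v := by linarith
        have h1 : Real.log v ≤ s := by
          rw [Real.log_le_iff_le_exp hv0]
          exact Real.quadratic_le_exp_of_nonneg hs0
        have h2 : Real.log u ≤ Real.log v + (u / v - 1) := by
          have := Real.log_le_sub_one_of_pos (div_pos hu0 hv0)
          rw [Real.log_div hu0.ne' hv0.ne'] at this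
          linarith
        have h3 : u / v - 1 ≤ u - v := by
          rw [div_sub_one hv0.ne']
          exact div_le_self (by linarith) hv1
        have h4 : Real.log u - u + 1 ≤ -(L / k) := by
          have : s ^ 2 / 2 = L / k := by rw [hs2]; ring
          linarith
        calc _ ≤ k * (-(L / k)) := mul_le_mul_of_nonneg_left h4 hk0.le
          _ = -L := by field_simp

end Chernoff

/-! ### The binomial tail as a Beta integral, and the moment problem on `[0, 1]`. -/

section Beta

open MeasureTheory Set

/-- The lower tail `∑_{k < m} (N choose k) ε^k (1-ε)^{N-k}` of the binomial distribution. -/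
noncomputable def binomialTail (m N : ℕ) (ε : ℝ) : ℝ :=
  ∑ k ∈ Finset.range m, (N.choose k : ℝ) * ε ^ k * (1 - ε) ^ (N - k)

lemma continuous_binomialTail (m N : ℕ) : Continuous (binomialTail m N) := by
  unfold binomialTail
  fun_prop

/-- The derivatives of the summands telescope because `(m+1) (N choose m+1) = (N-m) (N choose m)`.
For `1 ≤ m ≤ N`, what remains is minus the density of Beta(m, N-m+1). -/
lemma hasDerivAt_binomialTail (m N : ℕ) (x : ℝ) :
    HasDerivAt (binomialTail m N) (-(m * N.choose m * x ^ (m - 1) * (1 - x) ^ (N - m))) x := by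
  induction m with
  | zero =>
    have : binomialTail 0 N = fun _ => 0 := by ext; simp [binomialTail]
    rw [this]
    simpa using hasDerivAt_const x (0 : ℝ)
  | succ m ih =>
    have hs : binomialTail (m + 1) N =
        fun y => binomialTail m N y + (N.choose m : ℝ) * y ^ m * (1 - y) ^ (N - m) := by
      ext y; simp [binomialTail, Finset.sum_range_succ]
    rw [hs]
    have h1 : HasDerivAt (fun y : ℝ => (N.choose m : ℝ) * y ^ m * (1 - y) ^ (N - m))
        (N.choose m * (m * x ^ (m - 1)) * (1 - x) ^ (N - m) +
          N.choose m * x ^ m * ((N - m : ℕ) * (1 - x) ^ (N - m - 1) * (-1))) x := by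
      refine ((hasDerivAt_pow m x).const_mul _).mul ?_
      exact ((hasDerivAt_id x).const_sub 1).pow _
    refine (ih.add h1).congr_deriv ?_
    have hc : (N.choose (m + 1) : ℝ) * (m + 1) = N.choose m * (N - m : ℕ) := by
      exact_mod_cast Nat.choose_succ_right_eq N m
    rw [Nat.add_sub_cancel, Nat.sub_add_eq]
    push_cast
    linear_combination ((x ^ m * (1 - x) ^ (N - m - 1))) * hc

lemma binomialTail_one {m N : ℕ} (h : m ≤ N) : binomialTail m N 1 = 0 := by
  refine Finset.sum_eq_zero fun k hk => ?_
  have := Finset.mem_range.1 hk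
  rw [sub_self, zero_pow (by omega), mul_zero]

lemma binomialTail_zero {m N : ℕ} (h : 1 ≤ m) : binomialTail m N 0 = 1 := by
  unfold binomialTail
  rw [Finset.sum_eq_single 0]
  · simp
  · intro k _ hk; simp [hk]
  · intro h0; simp at h0; omega

lemma binomialTail_eq_one {m N : ℕ} (h : N < m) (ε : ℝ) : binomialTail m N ε = 1 := by
  have h1 := add_pow ε (1 - ε) N
  rw [add_sub_cancel, one_pow] at h1
  rw [h1]
  unfold binomialTail
  rw [← Finset.sum_subset (Finset.range_subset_range.2 (by omega : N + 1 ≤ m))]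
  · exact Finset.sum_congr rfl fun k _ => by ring
  · intro i _ hi
    rw [Nat.choose_eq_zero_of_lt (by simpa using hi)]
    simp

lemma integral_eq_binomialTail {m N : ℕ} (h : m ≤ N) (ε : ℝ) :
    ∫ x in ε..1, (m * N.choose m * x ^ (m - 1) * (1 - x) ^ (N - m) : ℝ) = binomialTail m N ε := by
  have := intervalIntegral.integral_eq_sub_of_hasDerivAt (a := ε) (b := 1)
    (fun x _ => hasDerivAt_binomialTail m N x)
    (Continuous.intervalIntegrable (by fun_prop) _ _)
  rw [binomialTail_one h, intervalIntegral.integral_neg] at this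
  linarith

/-- Measures on `[0, 1]` are determined by their moments. -/
lemma measure_ext_of_moments {μ ν : Measure ℝ} [IsProbabilityMeasure μ] [IsProbabilityMeasure ν]
    (hμ : ∀ᵐ x ∂μ, x ∈ Icc (0 : ℝ) 1) (hν : ∀ᵐ x ∂ν, x ∈ Icc (0 : ℝ) 1)
    (h : ∀ k : ℕ, ∫ x, (1 - x) ^ k ∂μ = ∫ x, (1 - x) ^ k ∂ν) : μ = ν := by
  have hint : ∀ (ρ : Measure ℝ) [IsProbabilityMeasure ρ], (∀ᵐ x ∂ρ, x ∈ Icc (0 : ℝ) 1) →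
      ∀ f : ℝ → ℝ, Continuous f → Integrable f ρ := by
    intro ρ _ hρ f hf
    obtain ⟨C, hC⟩ := isCompact_Icc.exists_bound_of_continuousOn (s := Icc (0 : ℝ) 1)
      hf.continuousOn
    exact Integrable.of_bound hf.aestronglyMeasurable C (hρ.mono fun x hx => hC x hx)
  have hpoly : ∀ p : Polynomial ℝ, ∫ x, p.eval x ∂μ = ∫ x, p.eval x ∂ν := by
    intro p
    have hp : ∀ x : ℝ, p.eval x = ∑ i ∈ Finset.range ((p.comp (1 - Polynomial.X)).natDegree + 1),
        (p.comp (1 - Polynomial.X)).coeff i * (1 - x) ^ i := by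
      intro x
      rw [← Polynomial.eval_eq_sum_range, Polynomial.eval_comp]
      simp
    simp_rw [hp]
    rw [integral_finsetSum, integral_finsetSum]
    · exact Finset.sum_congr rfl fun i _ => by rw [integral_const_mul, integral_const_mul, h]
    · exact fun i _ => hint ν hν _ (by fun_prop)
    · exact fun i _ => hint μ hμ _ (by fun_prop)
  refine ext_of_forall_integral_eq_of_IsFiniteMeasure fun f => ?_
  have key : ∀ η : ℝ, 0 < η → |∫ x, f x ∂μ - ∫ x, f x ∂ν| ≤ 2 * η := by
    intro η hη
    -- Weierstrass approximation: equality of the integrals of polynomials extends to continuous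
    -- functions.
    obtain ⟨p, hp⟩ := exists_polynomial_near_of_continuousOn 0 1 f f.continuous.continuousOn η hη
    have hd : ∀ (ρ : Measure ℝ) [IsProbabilityMeasure ρ], (∀ᵐ x ∂ρ, x ∈ Icc (0 : ℝ) 1) →
        |∫ x, p.eval x ∂ρ - ∫ x, f x ∂ρ| ≤ η := by
      intro ρ _ hρ
      rw [← integral_sub (hint ρ hρ _ p.continuous) (hint ρ hρ _ f.continuous)]
      have := norm_integral_le_of_norm_le_const (μ := ρ) (f := fun x => p.eval x - f x) (C := η)
        (hρ.mono fun x hx => (hp x hx).le)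
      simpa using this
    have h1 := abs_le.1 (hd μ hμ)
    have h2 := abs_le.1 (hd ν hν)
    rw [hpoly p] at h1
    rw [abs_le]
    constructor <;> linarith
  by_contra hne
  have hpos := abs_pos.2 (sub_ne_zero.2 hne)
  have := key _ (div_pos hpos (by norm_num : (0 : ℝ) < 4))
  linarith

/-- A random variable in `[0, 1]` whose moments are those of the Beta distribution `B(m, 1)` has
that distribution. -/
theorem integral_pow_eq_binomialTail {Ω : Type*} [MeasurableSpace Ω] {μ : Measure Ω}
    [IsProbabilityMeasure μ] {W : Ω → ℝ} (hW : Measurable W) (hW01 : ∀ ω, W ω ∈ Icc (0 : ℝ) 1)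
    {m : ℕ} (hm : 1 ≤ m)
    (h : ∀ k : ℕ, ((m + k).choose m : ℝ) * ∫ ω, (1 - W ω) ^ k ∂μ = 1)
    {N : ℕ} (hN : m ≤ N) {ε : ℝ} (hε : ε ∈ Icc (0 : ℝ) 1) :
    (N.choose m : ℝ) * ∫ ω in {ω | ε < W ω}, (1 - W ω) ^ (N - m) ∂μ = binomialTail m N ε := by
  set d : ℝ → ℝ := fun x => m * x ^ (m - 1) with hd
  have hd0 : ∀ x ∈ Icc (0 : ℝ) 1, 0 ≤ d x := fun x hx => by
    have := hx.1
    simp only [hd]; positivity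
  -- The law Beta(m, 1). Multiplying its density by `(1 - x)^k` and `(m+k).choose m` gives the
  -- density of Beta(m, k+1), whose total mass is 1; this identifies the moments.
  set ν : Measure ℝ := (volume.restrict (Ioc 0 1)).withDensity fun x => ENNReal.ofReal (d x) with hν
  have hdm : Measurable d := by fun_prop
  have hmeas : Measurable fun x => ENNReal.ofReal (d x) := hdm.ennreal_ofReal
  have hν0 : ∀ᵐ x ∂ν, x ∈ Ioc (0 : ℝ) 1 :=
    (withDensity_absolutelyContinuous _ _).ae_le (ae_restrict_mem measurableSet_Ioc)
  have hνs : ∀ᵐ x ∂ν, x ∈ Icc (0 : ℝ) 1 := hν0.mono fun x hx => Ioc_subset_Icc_self hx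
  have hνint : ∀ (e : ℝ) (f : ℝ → ℝ), e ∈ Icc (0 : ℝ) 1 →
      ∫ x in Ioi e, f x ∂ν = ∫ x in e..1, d x * f x := by
    intro e f he
    rw [hν, restrict_withDensity measurableSet_Ioi, Measure.restrict_restrict measurableSet_Ioi]
    have hs : Ioi e ∩ Ioc 0 1 = Ioc e 1 := by
      ext x; simp only [mem_inter_iff, mem_Ioi, mem_Ioc]
      constructor
      · rintro ⟨h1, -, h2⟩; exact ⟨h1, h2⟩
      · rintro ⟨h1, h2⟩; exact ⟨h1, he.1.trans_lt h1, h2⟩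
    rw [hs, intervalIntegral.integral_of_le he.2]
    rw [integral_withDensity_eq_integral_toReal_smul hmeas (by simp)]
    refine setIntegral_congr_fun measurableSet_Ioc fun x hx => ?_
    simp only [smul_eq_mul]
    rw [ENNReal.toReal_ofReal (hd0 x ⟨he.1.trans hx.1.le, hx.2⟩)]
  have hmom : ∀ k : ℕ, ((m + k).choose m : ℝ) * ∫ x, (1 - x) ^ k ∂ν = 1 := by
    intro k
    have h1 : ∫ x, (1 - x) ^ k ∂ν = ∫ x in Ioi 0, (1 - x) ^ k ∂ν := by
      rw [Measure.restrict_eq_self_of_ae_mem (s := Ioi 0) (hν0.mono fun x hx => hx.1)]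
    rw [h1, hνint 0 _ (by simp), ← intervalIntegral.integral_const_mul]
    refine Eq.trans ?_ ((integral_eq_binomialTail (Nat.le_add_right m k) 0).trans
      (binomialTail_zero hm))
    refine intervalIntegral.integral_congr fun x _ => ?_
    simp only [hd, Nat.add_sub_cancel_left]
    ring
  have hprob : IsProbabilityMeasure ν := by
    constructor
    rw [hν, withDensity_apply _ MeasurableSet.univ, Measure.restrict_univ,
      ← ofReal_integral_eq_lintegral_ofReal
        ((Continuous.integrableOn_Icc (by fun_prop)).mono_set Ioc_subset_Icc_self)
        ((ae_restrict_mem measurableSet_Ioc).mono fun x hx => hd0 x (Ioc_subset_Icc_self hx)),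
      ← intervalIntegral.integral_of_le zero_le_one]
    have h1 := (integral_eq_binomialTail (le_refl m) 0).trans (binomialTail_zero hm)
    simp only [Nat.choose_self, Nat.cast_one, mul_one, tsub_self, pow_zero] at h1
    rw [h1, ENNReal.ofReal_one]
  have : IsProbabilityMeasure (μ.map W) := Measure.isProbabilityMeasure_map hW.aemeasurable
  have hmap : μ.map W = ν := by
    refine measure_ext_of_moments ?_ hνs fun k => ?_
    · exact (ae_map_iff hW.aemeasurable measurableSet_Icc).2 (Filter.Eventually.of_forall hW01)
    · have hc : ((m + k).choose m : ℝ) ≠ 0 := by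
        exact_mod_cast (Nat.choose_pos (by omega)).ne'
      rw [integral_map hW.aemeasurable (by fun_prop)]
      exact mul_left_cancel₀ hc ((h k).trans (hmom k).symm)
  have hcont : Continuous fun x : ℝ => (1 - x) ^ (N - m) := by fun_prop
  have hset : ∫ ω in {ω | ε < W ω}, (1 - W ω) ^ (N - m) ∂μ =
      ∫ x in Ioi ε, (1 - x) ^ (N - m) ∂(μ.map W) :=
    (setIntegral_map measurableSet_Ioi hcont.aestronglyMeasurable hW.aemeasurable).symm
  rw [hset, hmap, hνint ε _ hε, ← intervalIntegral.integral_const_mul,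
    ← integral_eq_binomialTail hN]
  refine intervalIntegral.integral_congr fun x _ => ?_
  simp only [hd]
  ring

end Beta

/-! ### Convex programs: support constraints, Helly, measurability, well-posedness. -/

section Optimization

open MeasureTheory Set Filter Topology

variable {E Z ι : Type*} [NormedAddCommGroup E] [NormedSpace ℝ E]

/-- `θ` minimizes `J` over `C`. -/
def IsArgmin (J : E → ℝ) (C : Set E) (θ : E) : Prop := θ ∈ C ∧ ∀ θ' ∈ C, J θ ≤ J θ'

/-- A minimizer of `J` over `C`, if there is one. -/
noncomputable def argmin (J : E → ℝ) (C : Set E) : E := Classical.epsilon (IsArgmin J C)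

/-- The set cut out by the constraints `0 ≤ g θ (s i)`, `i ∈ U`. -/
def feasibleSet (g : E → Z → ℝ) (s : ι → Z) (U : Set ι) : Set E := {θ | ∀ i ∈ U, 0 ≤ g θ (s i)}

/-- The solution of the program with the constraints of the samples `s i`, `i ∈ U`. -/
noncomputable def opt (J : E → ℝ) (g : E → Z → ℝ) (s : ι → Z) (U : Set ι) : E :=
  argmin J (feasibleSet g s U)

/-- A strictly convex and coercive objective, with concave random constraints `0 ≤ g θ z` that are
satisfiable simultaneously. -/
structure IsConvexProgram [MeasurableSpace Z] (J : E → ℝ) (g : E → Z → ℝ) : Prop where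
  strictConvex : StrictConvexOn ℝ univ J
  continuous : Continuous J
  compact : ∀ r, IsCompact {θ | J θ ≤ r}
  concave : ∀ z, ConcaveOn ℝ univ fun θ => g θ z
  continuous_constraint : ∀ z, Continuous fun θ => g θ z
  measurable_constraint : ∀ θ, Measurable (g θ)
  exists_feasible : ∃ θ, ∀ z, 0 ≤ g θ z

lemma IsArgmin.unique {J : E → ℝ} (hJ : StrictConvexOn ℝ univ J) {C : Set E} (hC : Convex ℝ C)
    {θ θ' : E} (h : IsArgmin J C θ) (h' : IsArgmin J C θ') : θ = θ' := by
  by_contra hne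
  have hmid := hJ.2 (mem_univ θ) (mem_univ θ') hne (by norm_num : (0 : ℝ) < 1 / 2)
    (by norm_num : (0 : ℝ) < 1 / 2) (by norm_num)
  have h1 := h.2 _ (hC h.1 h'.1 (by norm_num : (0 : ℝ) ≤ 1 / 2) (by norm_num : (0 : ℝ) ≤ 1 / 2)
    (by norm_num))
  have h2 := h'.2 _ h.1
  simp only [smul_eq_mul] at hmid
  linarith

lemma exists_isArgmin {J : E → ℝ} (hJ : Continuous J) (hc : ∀ r, IsCompact {θ | J θ ≤ r})
    {C : Set E} (hC : IsClosed C) (hne : C.Nonempty) : ∃ θ, IsArgmin J C θ := by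
  obtain ⟨θ₀, h₀⟩ := hne
  obtain ⟨θ, hθ, hmin⟩ := ((hc (J θ₀)).inter_right hC).exists_isMinOn ⟨θ₀, le_refl (J θ₀), h₀⟩
    hJ.continuousOn
  refine ⟨θ, hθ.2, fun θ' h' => ?_⟩
  rcases le_total (J θ') (J θ₀) with h | h
  · exact hmin ⟨h, h'⟩
  · exact hθ.1.trans h

namespace IsConvexProgram

variable [MeasurableSpace Z] {J : E → ℝ} {g : E → Z → ℝ}

lemma convex_feasibleSet (hP : IsConvexProgram J g) (s : ι → Z) (U : Set ι) :
    Convex ℝ (feasibleSet g s U) := by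
  intro θ h θ' h' a b ha hb hab i hi
  have := (hP.concave (s i)).2 (mem_univ θ) (mem_univ θ') ha hb hab
  simp only [smul_eq_mul] at this
  exact (add_nonneg (mul_nonneg ha (h i hi)) (mul_nonneg hb (h' i hi))).trans this

lemma isClosed_feasibleSet (hP : IsConvexProgram J g) (s : ι → Z) (U : Set ι) :
    IsClosed (feasibleSet g s U) := by
  have : feasibleSet g s U = ⋂ i ∈ U, {θ | 0 ≤ g θ (s i)} := by
    ext; simp [feasibleSet]
  rw [this]
  exact isClosed_biInter fun i _ => isClosed_le continuous_const (hP.continuous_constraint _)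

lemma isArgmin_opt (hP : IsConvexProgram J g) (s : ι → Z) (U : Set ι) :
    IsArgmin J (feasibleSet g s U) (opt J g s U) := by
  obtain ⟨θ₀, h₀⟩ := hP.exists_feasible
  exact Classical.epsilon_spec (exists_isArgmin hP.continuous hP.compact
    (hP.isClosed_feasibleSet s U) ⟨θ₀, fun i _ => h₀ _⟩)

lemma opt_eq (hP : IsConvexProgram J g) {s : ι → Z} {U : Set ι} {θ : E}
    (h : IsArgmin J (feasibleSet g s U) θ) : opt J g s U = θ :=
  (hP.isArgmin_opt s U).unique hP.strictConvex (hP.convex_feasibleSet s U) h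

/-- Only the set of constraint points matters, so families can be reindexed and restricted freely.
-/
lemma opt_congr {κ : Type*} {s : ι → Z} {U : Set ι} {r : κ → Z} {V : Set κ}
    (h : s '' U = r '' V) : opt J g s U = opt J g r V := by
  have : feasibleSet g s U = feasibleSet g r V := by
    ext θ
    have h1 : θ ∈ feasibleSet g s U ↔ ∀ z ∈ s '' U, 0 ≤ g θ z := by
      simp [feasibleSet]
    have h2 : θ ∈ feasibleSet g r V ↔ ∀ z ∈ r '' V, 0 ≤ g θ z := by
      simp [feasibleSet]
    rw [h1, h2, h]
  rw [opt, opt, this]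

/-- Constraints that the current solution already satisfies do not move it when they are added. -/
lemma opt_eq_of_subset (hP : IsConvexProgram J g) {s : ι → Z} {U V : Set ι} (hUV : U ⊆ V)
    (h : ∀ j ∈ V, 0 ≤ g (opt J g s U) (s j)) : opt J g s V = opt J g s U :=
  hP.opt_eq ⟨h, fun θ' h' => (hP.isArgmin_opt s U).2 θ' fun i hi => h' i (hUV hi)⟩

lemma opt_eq_of_subset_of_subset (hP : IsConvexProgram J g) {s : ι → Z} {U V W : Set ι}
    (hUV : U ⊆ V) (hVW : V ⊆ W) (h : opt J g s U = opt J g s W) : opt J g s V = opt J g s W := by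
  rw [← h]
  refine hP.opt_eq_of_subset hUV fun j hj => ?_
  rw [h]
  exact (hP.isArgmin_opt s W).1 j (hVW hj)

/-- An inactive constraint can be removed. -/
lemma opt_diff_singleton (hP : IsConvexProgram J g) {s : ι → Z} {U : Set ι} {i : ι}
    (hi : 0 < g (opt J g s U) (s i)) : opt J g s (U \ {i}) = opt J g s U := by
  have hU := hP.isArgmin_opt s U
  set θ := opt J g s U
  refine hP.opt_eq ⟨fun j hj => hU.1 j hj.1, fun θ' h' => ?_⟩
  by_contra hlt
  push Not at hlt
  set A := g θ (s i)
  set B := g θ' (s i)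
  have hden : 0 < A + |B| := add_pos_of_pos_of_nonneg hi (abs_nonneg B)
  -- The solution of `(1 - β)A = β|B|`: moving by this fraction towards the better point `θ'` keeps
  -- constraint `i` satisfied, by concavity, while `J` strictly decreases.
  set β := A / (A + |B|) with hβ
  have hβ0 : 0 < β := div_pos hi hden
  have hβ1 : β ≤ 1 := (div_le_one hden).2 (by linarith [abs_nonneg B])
  have hβA : β * (A + |B|) = A := div_mul_cancel₀ _ hden.ne'
  have hmem : (1 - β) • θ + β • θ' ∈ feasibleSet g s U := by
    intro j hj
    have hc := (hP.concave (s j)).2 (mem_univ θ) (mem_univ θ') (sub_nonneg.2 hβ1) hβ0.le (by ring)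
    simp only [smul_eq_mul] at hc
    refine le_trans ?_ hc
    by_cases hji : j = i
    · rw [hji]
      change 0 ≤ (1 - β) * A + β * B
      nlinarith [neg_abs_le B]
    · exact add_nonneg (mul_nonneg (sub_nonneg.2 hβ1) (hU.1 j hj))
        (mul_nonneg hβ0.le (h' j ⟨hj, hji⟩))
  have h1 := hU.2 _ hmem
  have h2 := hP.strictConvex.convexOn.2 (mem_univ θ) (mem_univ θ') (sub_nonneg.2 hβ1) hβ0.le
    (by ring)
  simp only [smul_eq_mul] at h2
  nlinarith

/-- Helly: as many constraints as there are variables determine the solution. -/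
lemma exists_card_eq_finrank [FiniteDimensional ℝ E] [Fintype ι] (hP : IsConvexProgram J g)
    (s : ι → Z) (hcard : Module.finrank ℝ E ≤ Fintype.card ι) :
    ∃ I : Finset ι, I.card = Module.finrank ℝ E ∧ opt J g s I = opt J g s univ := by
  classical
  by_contra hcon
  push Not at hcon
  have hU := hP.isArgmin_opt s univ
  set θ := opt J g s univ
  -- Helly is applied to the constraint sets together with the strict sublevel set of the optimal
  -- value. If no `m` constraints (`m` the dimension) determined `θ`, the solution for any `m` of
  -- them would have a strictly smaller value. Then any `m + 1` members of the family would meet,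
  -- hence all of them, contradicting optimality of `θ`.
  let F : Option ι → Set E := fun o => o.elim {θ' | J θ' < J θ} fun i => {θ' | 0 ≤ g θ' (s i)}
  have hF := Convex.helly_theorem' (𝕜 := ℝ) (F := F) (s := Finset.univ) ?_ ?_
  · obtain ⟨θ', h'⟩ := hF
    simp only [mem_iInter] at h'
    have h1 : J θ' < J θ := h' none (Finset.mem_univ _)
    exact absurd (hU.2 θ' fun i _ => h' (some i) (Finset.mem_univ _)) (not_le.2 h1)
  · rintro (_ | i) -
    · have h := hP.strictConvex.convexOn.convex_lt (J θ)
      simp only [mem_univ, true_and] at h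
      exact h
    · have h := (hP.concave (s i)).convex_ge 0
      simp only [mem_univ, true_and] at h
      exact h
  · intro K _ hK
    by_cases hn : none ∈ K
    · have hcK : (Finset.eraseNone K).card ≤ Module.finrank ℝ E := by
        rw [Finset.card_eraseNone_of_mem hn]; omega
      obtain ⟨I, hKI, hI⟩ := Finset.exists_superset_card_eq hcK (by simpa using hcard)
      have hI' := hP.isArgmin_opt s (I : Set ι)
      have hθI : θ ∈ feasibleSet g s I := fun i _ => hU.1 i (mem_univ i)
      refine ⟨opt J g s I, mem_iInter₂.2 ?_⟩
      rintro (_ | i) hi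
      · refine lt_of_le_of_ne (hI'.2 θ hθI) fun he => hcon I hI ?_
        exact hP.opt_eq ⟨hθI, fun θ' h' => he ▸ hI'.2 θ' h'⟩
      · exact hI'.1 i (hKI (Finset.mem_eraseNone.2 hi))
    · refine ⟨θ, mem_iInter₂.2 ?_⟩
      rintro (_ | i) hi
      · exact absurd hi hn
      · exact hU.1 i (mem_univ i)

/-- By compactness, a feasible point of `K` exists if and only if, for every `n`, a countable dense
subset of `K` contains a point violating each constraint by less than `1/(n+1)`. -/
lemma measurableSet_exists_feasible [FiniteDimensional ℝ E] [Finite ι] (hP : IsConvexProgram J g)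
    (U : Set ι) {K : Set E} (hK : IsCompact K) :
    MeasurableSet {s : ι → Z | ∃ θ ∈ K, θ ∈ feasibleSet g s U} := by
  have : SecondCountableTopology E := by
    have := FiniteDimensional.proper_real E
    infer_instance
  obtain ⟨D, hDc, hD⟩ := TopologicalSpace.exists_countable_dense K
  have hset : {s : ι → Z | ∃ θ ∈ K, θ ∈ feasibleSet g s U} =
      ⋂ n : ℕ, ⋃ d ∈ D, ⋂ i ∈ U, {s | -(1 / ((n : ℝ) + 1)) < g (d : E) (s i)} := by
    ext s
    simp only [mem_ofPred_eq, mem_iInter, mem_iUnion, exists_prop]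
    constructor
    · rintro ⟨θ, hθK, hθ⟩ n
      have hopen : IsOpen (⋂ i ∈ U, {d : K | -(1 / ((n : ℝ) + 1)) < g (d : E) (s i)}) :=
        (toFinite U).isOpen_biInter fun i _ => isOpen_lt continuous_const
          ((hP.continuous_constraint _).comp continuous_subtype_val)
      obtain ⟨d, hd, hdD⟩ := hD.inter_open_nonempty _ hopen ⟨⟨θ, hθK⟩, by
        simp only [mem_iInter, mem_ofPred_eq]
        intro i hi
        exact lt_of_lt_of_le (neg_lt_zero.2 Nat.one_div_pos_of_nat) (hθ i hi)⟩
      simp only [mem_iInter, mem_ofPred_eq] at hd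
      exact ⟨d, hdD, hd⟩
    · intro h
      choose d _ hd using h
      obtain ⟨θ, hθ, φ, hφ, hlim⟩ := hK.tendsto_subseq fun n => (d n).2
      refine ⟨θ, hθ, fun i hi => ?_⟩
      have h1 : Tendsto (fun n => g (d (φ n) : E) (s i)) atTop (𝓝 (g θ (s i))) :=
        ((hP.continuous_constraint (s i)).tendsto θ).comp hlim
      have h2 : Tendsto (fun n => -(1 / ((φ n : ℝ) + 1))) atTop (𝓝 0) := by
        rw [← neg_zero]
        exact ((tendsto_one_div_add_atTop_nhds_zero_nat (𝕜 := ℝ)).comp hφ.tendsto_atTop).neg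
      exact le_of_tendsto_of_tendsto h2 h1 (Eventually.of_forall fun n => (hd (φ n) i hi).le)
  rw [hset]
  refine MeasurableSet.iInter fun n => MeasurableSet.biUnion hDc fun d _ => ?_
  exact MeasurableSet.biInter (to_countable U) fun i _ =>
    measurableSet_lt measurable_const ((hP.measurable_constraint d).comp (measurable_pi_apply i))

/-- The solution lies in a closed set `F` if and only if, at every rational level `q`, existence of
a feasible point with `J ≤ q` implies existence of one in `F`; uniqueness of the minimizer gives the
converse. -/
lemma measurable_opt [FiniteDimensional ℝ E] [MeasurableSpace E] [BorelSpace E] [Finite ι]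
    (hP : IsConvexProgram J g) (U : Set ι) : Measurable fun s : ι → Z => opt J g s U := by
  refine measurable_of_isClosed fun F hF => ?_
  have hset : (fun s : ι → Z => opt J g s U) ⁻¹' F =
      ⋂ q : ℚ, ({s | ∃ θ ∈ {θ | J θ ≤ q}, θ ∈ feasibleSet g s U}ᶜ ∪
        {s | ∃ θ ∈ {θ | J θ ≤ q} ∩ F, θ ∈ feasibleSet g s U}) := by
    ext s
    have hs := hP.isArgmin_opt s U
    simp only [mem_preimage, mem_iInter, mem_union, mem_compl_iff, mem_ofPred_eq, mem_inter_iff]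
    constructor
    · intro h q
      by_cases hq : ∃ θ, J θ ≤ q ∧ θ ∈ feasibleSet g s U
      · obtain ⟨θ, h1, h2⟩ := hq
        exact Or.inr ⟨_, ⟨(hs.2 θ h2).trans h1, h⟩, hs.1⟩
      · exact Or.inl hq
    · intro h
      have hex : ∀ q : ℚ, J (opt J g s U) ≤ q →
          ∃ θ, (J θ ≤ q ∧ θ ∈ F) ∧ θ ∈ feasibleSet g s U := fun q hq =>
        (h q).resolve_left (not_not.2 ⟨_, hq, hs.1⟩)
      obtain ⟨q₀, hq₀⟩ := exists_rat_gt (J (opt J g s U))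
      obtain ⟨θ₀, h₀, h₀'⟩ := hex q₀ hq₀.le
      obtain ⟨θ, hθ⟩ := exists_isArgmin hP.continuous hP.compact
        ((hP.isClosed_feasibleSet s U).inter hF) ⟨θ₀, h₀', h₀.2⟩
      have hle : J θ ≤ J (opt J g s U) := by
        refine le_of_forall_gt_imp_ge_of_dense fun r hr => ?_
        obtain ⟨q, hq1, hq2⟩ := exists_rat_btwn hr
        obtain ⟨θ', h1, h2⟩ := hex q hq1.le
        exact ((hθ.2 θ' ⟨h2, h1.2⟩).trans h1.1).trans hq2.le
      rw [hP.opt_eq ⟨hθ.1.1, fun θ' h' => hle.trans (hs.2 θ' h')⟩]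
      exact hθ.1.2
  rw [hset]
  exact MeasurableSet.iInter fun q => (hP.measurableSet_exists_feasible U (hP.compact q)).compl.union
    (hP.measurableSet_exists_feasible U ((hP.compact q).inter_right hF))

lemma measurable_uncurry_constraint [FiniteDimensional ℝ E] [MeasurableSpace E] [BorelSpace E]
    (hP : IsConvexProgram J g) : Measurable (Function.uncurry g) := by
  have : SecondCountableTopology E := by
    have := FiniteDimensional.proper_real E
    infer_instance
  exact measurable_uncurry_of_continuous_of_measurable (u := g) hP.continuous_constraint
    hP.measurable_constraint

end IsConvexProgram

/-- If a family of convex inequalities has a unique common solution, then this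
solution is well-posed. -/
lemma exists_modulus [FiniteDimensional ℝ E] {φ : ι → E → ℝ} (hconv : ∀ j, ConvexOn ℝ univ (φ j))
    (hcont : ∀ j, Continuous (φ j)) {θ₀ : E} (h₀ : ∀ j, φ j θ₀ ≤ 0)
    (huniq : ∀ θ, θ ≠ θ₀ → ∃ j, 0 < φ j θ) {ρ : ℝ} (hρ : 0 < ρ) :
    ∃ κ > 0, ∀ θ, (∀ j, φ j θ < κ) → ‖θ - θ₀‖ < ρ := by
  have := FiniteDimensional.proper_real E
  by_contra! hcon
  choose θ hθ hfar using fun n : ℕ => hcon (1 / ((n : ℝ) + 1)) Nat.one_div_pos_of_nat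
  have hpos : ∀ n, 0 < ‖θ n - θ₀‖ := fun n => hρ.trans_le (hfar n)
  -- The far points are pulled back along segments to the sphere of radius `ρ`. Convexity preserves
  -- the approximate inequalities, so a limit point on the sphere is a second common solution.
  set β : ℕ → ℝ := fun n => ρ / ‖θ n - θ₀‖ with hβ
  have hβ0 : ∀ n, 0 ≤ β n := fun n => (div_pos hρ (hpos n)).le
  have hβ1 : ∀ n, β n ≤ 1 := fun n => (div_le_one (hpos n)).2 (hfar n)
  set η : ℕ → E := fun n => (1 - β n) • θ₀ + β n • θ n with hη
  have hηs : ∀ n, η n ∈ Metric.sphere θ₀ ρ := by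
    intro n
    have h1 : η n - θ₀ = β n • (θ n - θ₀) := by simp only [hη]; module
    rw [mem_sphere_iff_norm, h1, norm_smul, Real.norm_of_nonneg (hβ0 n)]
    exact div_mul_cancel₀ _ (hpos n).ne'
  have hηφ : ∀ n j, φ j (η n) ≤ 1 / ((n : ℝ) + 1) := by
    intro n j
    have h1 := (hconv j).2 (mem_univ θ₀) (mem_univ (θ n)) (sub_nonneg.2 (hβ1 n)) (hβ0 n) (by ring)
    simp only [smul_eq_mul] at h1
    have h2 : (0 : ℝ) ≤ 1 / ((n : ℝ) + 1) := Nat.one_div_pos_of_nat.le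
    have h3 := (hθ n j).le
    have h4 : (1 - β n) * φ j θ₀ ≤ 0 :=
      mul_nonpos_of_nonneg_of_nonpos (sub_nonneg.2 (hβ1 n)) (h₀ j)
    have h5 : β n * φ j (θ n) ≤ β n * (1 / ((n : ℝ) + 1)) := mul_le_mul_of_nonneg_left h3 (hβ0 n)
    have h6 : β n * (1 / ((n : ℝ) + 1)) ≤ 1 / ((n : ℝ) + 1) := mul_le_of_le_one_left h2 (hβ1 n)
    linarith
  obtain ⟨θ', h', ψ, hψ, hlim⟩ := (isCompact_sphere θ₀ ρ).tendsto_subseq hηs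
  obtain ⟨j, hj⟩ := huniq θ' (by
    rintro rfl
    simp [hρ.ne] at h')
  have h1 : Tendsto (fun n => φ j (η (ψ n))) atTop (𝓝 (φ j θ')) :=
    ((hcont j).tendsto θ').comp hlim
  have h2 : Tendsto (fun n => 1 / ((ψ n : ℝ) + 1)) atTop (𝓝 0) :=
    tendsto_one_div_add_atTop_nhds_zero_nat.comp hψ.tendsto_atTop
  exact absurd (le_of_tendsto_of_tendsto h1 h2 (Eventually.of_forall fun n => hηφ _ _))
    (not_le.2 hj)

end Optimization

/-! ### The unique dominating subfamily. -/

section Compression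

open MeasureTheory Set Filter Topology

variable {E Z ι : Type*} [NormedAddCommGroup E] [NormedSpace ℝ E] [MeasurableSpace Z]
  {J : E → ℝ} {g : E → Z → ℝ}

/-- The samples that can be added to the family `r` without changing which of its members are
selected: the solution for `r` remains feasible, and the tag is larger than the tags of all members
of `r` that are not needed for determining this solution. -/
def dominated {κ : Type*} (J : E → ℝ) (g : E → Z → ℝ) (τ : Z → ℝ) (r : κ → Z) : Set Z :=
  {z | 0 ≤ g (opt J g r univ) z ∧
    ∀ k, opt J g r (univ \ {k}) = opt J g r univ → τ (r k) < τ z}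

lemma dominated_comp_equiv {κ κ' : Type*} (τ : Z → ℝ) (e : κ ≃ κ') (r : κ' → Z) :
    dominated J g τ (r ∘ e) = dominated J g τ r := by
  have h1 : opt J g (r ∘ e) univ = opt J g r univ := by
    refine IsConvexProgram.opt_congr ?_
    rw [image_comp, image_univ_of_surjective e.surjective]
  have h2 : ∀ k, opt J g (r ∘ e) (univ \ {k}) = opt J g r (univ \ {e k}) := by
    intro k
    refine IsConvexProgram.opt_congr ?_
    rw [image_comp, image_sdiff e.injective, image_univ_of_surjective e.surjective,
      image_singleton]
  ext z
  simp only [dominated, mem_ofPred_eq, h1, h2, Function.comp_apply]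
  exact and_congr_right fun _ => e.forall_congr_left.trans (by simp)

lemma opt_restrict (s : ι → Z) (I : Finset ι) :
    opt J g (fun i : I => s i) univ = opt J g s I := by
  refine IsConvexProgram.opt_congr ?_
  ext z; simp

lemma mem_dominated_restrict (τ : Z → ℝ) (s : ι → Z) (I : Finset ι) (z : Z) :
    z ∈ dominated J g τ (fun i : I => s i) ↔ 0 ≤ g (opt J g s I) z ∧
      ∀ k ∈ I, opt J g s (I \ {k}) = opt J g s I → τ (s k) < τ z := by
  have h2 : ∀ k : I, opt J g (fun i : I => s i) (univ \ {k}) = opt J g s (I \ {(k : ι)}) := by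
    intro k
    refine IsConvexProgram.opt_congr ?_
    ext z
    simp only [mem_image, Set.mem_sdiff, mem_univ, true_and, mem_singleton_iff, Subtype.exists,
      Subtype.ext_iff, Finset.mem_coe]
    constructor
    · rintro ⟨i, hi, hik, rfl⟩; exact ⟨i, ⟨hi, hik⟩, rfl⟩
    · rintro ⟨i, ⟨hi, hik⟩, rfl⟩; exact ⟨i, hi, hik, rfl⟩
  simp only [dominated, mem_ofPred_eq, opt_restrict, h2, Subtype.forall]

/-- For samples in general position, exactly one subfamily of the right size dominates the other
samples. -/
lemma existsUnique_dominating [FiniteDimensional ℝ E] [Fintype ι] (hP : IsConvexProgram J g)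
    {τ : Z → ℝ} {s : ι → Z} (hτ : Function.Injective (τ ∘ s))
    (hnd : ∀ i, g (opt J g s (univ \ {i})) (s i) ≠ 0)
    (hcard : Module.finrank ℝ E ≤ Fintype.card ι) :
    ∃! I : Finset ι, I.card = Module.finrank ℝ E ∧
      ∀ j ∉ I, s j ∈ dominated J g τ (fun i : I => s i) := by
  classical
  simp only [mem_dominated_restrict]
  have hU := hP.isArgmin_opt s univ
  set θ := opt J g s univ with hθ
  -- The support constraints, those whose removal changes the solution. Every subfamily that
  -- determines `θ` contains them.
  set S : Finset ι := {i | opt J g s (univ \ {i}) ≠ θ} with hS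
  have hmemS : ∀ i, i ∈ S ↔ opt J g s (univ \ {i}) ≠ θ := fun i => by simp [hS]
  have sub_of_opt : ∀ I : Finset ι, opt J g s I = θ → S ⊆ I := by
    intro I hI i hi
    by_contra hiI
    refine (hmemS i).1 hi (hP.opt_eq_of_subset_of_subset (U := (I : Set ι)) ?_ (subset_univ _) hI)
    intro j hj
    exact ⟨mem_univ _, fun hji => hiI (by rw [← mem_singleton_iff.1 hji]; exact hj)⟩
  -- Nondegeneracy enters here: by `hnd`, a constraint that is not of support is strictly inactive
  -- at `θ`, so it can be dropped from any subfamily determining `θ`. A minimal such subfamily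
  -- therefore lies in `S`.
  have hSθ : opt J g s S = θ := by
    obtain ⟨I, hI, hmin⟩ := (measure Finset.card).wf.has_min {I : Finset ι | opt J g s I = θ}
      ⟨Finset.univ, by simp [hθ]⟩
    have hIS : I ⊆ S := by
      intro i hi
      rw [hmemS]
      intro hcon
      have hpos : 0 < g (opt J g s I) (s i) := by
        rw [show opt J g s I = θ from hI]
        refine lt_of_le_of_ne (hU.1 i (mem_univ i)) (Ne.symm ?_)
        rw [← hcon]
        exact hnd i
      refine hmin (I.erase i) ?_ (Finset.card_erase_lt_of_mem hi)
      have := hP.opt_diff_singleton hpos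
      simp only [mem_ofPred_eq, Finset.coe_erase]
      rw [this]; exact hI
    exact hP.opt_eq_of_subset_of_subset (U := (I : Set ι)) (by exact_mod_cast hIS)
      (subset_univ _) hI
  have opt_of_sub : ∀ V : Set ι, (S : Set ι) ⊆ V → opt J g s V = θ := fun V hV =>
    hP.opt_eq_of_subset_of_subset hV (subset_univ _) hSθ
  obtain ⟨I₁, hI₁, hI₁θ⟩ := hP.exists_card_eq_finrank s hcard
  have good_sub : ∀ I : Finset ι, (∀ j ∉ I, 0 ≤ g (opt J g s I) (s j)) → S ⊆ I := by
    intro I hI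
    refine sub_of_opt I (hP.opt_eq_of_subset (subset_univ _) fun j _ => ?_).symm
    by_cases hj : j ∈ I
    · exact (hP.isArgmin_opt s (I : Set ι)).1 j hj
    · exact hI j hj
  have redundant : ∀ I : Finset ι, S ⊆ I → ∀ i ∉ S, opt J g s (I \ {i}) = opt J g s I := by
    intro I hSI i hi
    rw [opt_of_sub I (by exact_mod_cast hSI), opt_of_sub]
    intro j hj
    exact ⟨hSI hj, fun hji => hi (by rw [← mem_singleton_iff.1 hji]; exact hj)⟩
  refine existsUnique_of_exists_of_unique ?_ ?_
  -- Among the `m`-subsets containing `S`, with `m` the dimension, take one with minimal sum of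
  -- tags. Exchanging a redundant member for an outsider with a smaller tag would lower the sum.
  · let T : Finset (Finset ι) := {I | I.card = Module.finrank ℝ E ∧ S ⊆ I}
    obtain ⟨I, hIT, hmin⟩ := T.exists_min_image (fun I => ∑ i ∈ I, τ (s i))
      ⟨I₁, by simp [T, hI₁, sub_of_opt I₁ hI₁θ]⟩
    obtain ⟨hIc, hSI⟩ : I.card = Module.finrank ℝ E ∧ S ⊆ I := by simpa [T] using hIT
    have hIθ : opt J g s I = θ := opt_of_sub I (by exact_mod_cast hSI)
    refine ⟨I, hIc, fun j hj => ⟨?_, fun k hk hred => ?_⟩⟩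
    · rw [hIθ]; exact hU.1 j (mem_univ j)
    · have hkS : k ∉ S := by
        rw [hmemS, not_not]
        exact hP.opt_eq_of_subset_of_subset (U := (I : Set ι) \ {k})
          (sdiff_subset_sdiff_left (subset_univ _)) (subset_univ _) (hred.trans hIθ)
      by_contra hle
      have hne : τ (s j) ≠ τ (s k) := fun h => hj (by rw [show j = k from hτ h]; exact hk)
      have hlt : τ (s j) < τ (s k) := lt_of_le_of_ne (not_lt.1 hle) hne
      have hjk : j ∉ I.erase k := fun h => hj (Finset.mem_of_mem_erase h)
      have h1 := hmin (insert j (I.erase k)) (by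
        simp only [T, Finset.mem_filter, Finset.mem_univ, true_and]
        refine ⟨?_, fun i hi => Finset.mem_insert_of_mem (Finset.mem_erase.2 ⟨?_, hSI hi⟩)⟩
        · rw [Finset.card_insert_of_notMem hjk, Finset.card_erase_add_one hk, hIc]
        · rintro rfl; exact hkS hi)
      rw [Finset.sum_insert hjk, ← Finset.add_sum_erase I _ hk] at h1
      linarith
  -- Both subsets contain `S`, so members of `I \ I'` and `I' \ I` are redundant and would each have
  -- a smaller tag than the other.
  · rintro I I' ⟨hI, hgI⟩ ⟨hI', hgI'⟩
    by_contra hne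
    have hSI := good_sub I fun j hj => (hgI j hj).1
    have hSI' := good_sub I' fun j hj => (hgI' j hj).1
    obtain ⟨i, hi, hi'⟩ : ∃ i ∈ I, i ∉ I' := Finset.not_subset.1 fun h =>
      hne (Finset.eq_of_subset_of_card_le h (by omega))
    obtain ⟨j, hj, hj'⟩ : ∃ j ∈ I', j ∉ I := Finset.not_subset.1 fun h =>
      hne (Finset.eq_of_subset_of_card_le h (by omega)).symm
    have h1 := (hgI j hj').2 i hi (redundant I hSI i fun h => hi' (hSI' h))
    have h2 := (hgI' i hi').2 j hj (redundant I' hSI' j fun h => hj' (hSI h))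
    exact lt_asymm h1 h2

variable [FiniteDimensional ℝ E] [MeasurableSpace E] [BorelSpace E]

lemma measurableSet_dominated {κ : Type*} [Finite κ] (hP : IsConvexProgram J g) {τ : Z → ℝ}
    (hτ : Measurable τ) : MeasurableSet {p : (κ → Z) × Z | p.2 ∈ dominated J g τ p.1} := by
  have h1 : Measurable fun p : (κ → Z) × Z => g (opt J g p.1 univ) p.2 :=
    hP.measurable_uncurry_constraint.comp
      (((hP.measurable_opt univ).comp measurable_fst).prodMk measurable_snd)
  have hset : {p : (κ → Z) × Z | p.2 ∈ dominated J g τ p.1} =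
      {p | 0 ≤ g (opt J g p.1 univ) p.2} ∩ ⋂ k : κ,
        ({p | opt J g p.1 (univ \ {k}) = opt J g p.1 univ}ᶜ ∪ {p | τ (p.1 k) < τ p.2}) := by
    ext p
    simp only [dominated, mem_ofPred_eq, mem_inter_iff, mem_iInter, mem_union, mem_compl_iff,
      imp_iff_not_or]
  rw [hset]
  have : SecondCountableTopology E := by
    have := FiniteDimensional.proper_real E
    infer_instance
  refine (measurableSet_le measurable_const h1).inter (MeasurableSet.iInter fun k => ?_)
  refine MeasurableSet.union (MeasurableSet.compl ?_) (measurableSet_lt ?_ ?_)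
  · exact measurableSet_eq_fun ((hP.measurable_opt _).comp measurable_fst)
      ((hP.measurable_opt _).comp measurable_fst)
  · exact hτ.comp ((measurable_pi_apply k).comp measurable_fst)
  · exact hτ.comp measurable_snd

end Compression

/-! ### Conditioning in product measures. -/

section ProductMeasure

open MeasureTheory Set Filter Topology

variable {Z : Type*} [MeasurableSpace Z] (P : Measure Z) [IsProbabilityMeasure P]

lemma measure_pi_null_of_section {N : ℕ} (i : Fin (N + 1)) {B : Set (Z × (Fin N → Z))}
    (hB : MeasurableSet B) (h : ∀ r, P {z | (z, r) ∈ B} = 0) :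
    Measure.pi (fun _ : Fin (N + 1) => P) {s | (s i, fun j => s (i.succAbove j)) ∈ B} = 0 := by
  have hmp := measurePreserving_piFinSuccAbove (fun _ : Fin (N + 1) => P) i
  have h1 := hmp.measure_preimage hB.nullMeasurableSet
  refine Eq.trans ?_ (h1.trans ?_)
  · rfl
  · rw [Measure.prod_apply_symm hB]
    simp only [lintegral_eq_zero_iff (measurable_measure_prodMk_right hB)]
    exact Eventually.of_forall h

/-- Conditionally on the samples with index in `I`, the others are independent. -/
lemma measure_pi_forall_notMem {ι : Type*} [Fintype ι] (I : Finset ι) {A : Set ((I → Z) × Z)}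
    (hA : MeasurableSet A) {B : Set (I → Z)} (hB : MeasurableSet B) :
    Measure.pi (fun _ : ι => P) {s | (fun i : I => s i) ∈ B ∧
        ∀ j ∉ I, ((fun i : I => s i), s j) ∈ A} =
      ∫⁻ r in B, P {z | (r, z) ∈ A} ^ (Fintype.card ι - I.card)
        ∂(Measure.pi fun _ : I => P) := by
  classical
  have hmp : MeasurePreserving (MeasurableEquiv.piEquivPiSubtypeProd (fun _ : ι => Z) (· ∈ I))
      (Measure.pi fun _ => P) ((Measure.pi fun _ : I => P).prod (Measure.pi fun _ => P)) := by
    convert measurePreserving_piEquivPiSubtypeProd (fun _ : ι => P) (· ∈ I)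
  set C : Set (({i // i ∈ I} → Z) × ({i // ¬ i ∈ I} → Z)) :=
    {p | p.1 ∈ B ∧ ∀ j, (p.1, p.2 j) ∈ A} with hC
  have hCm : MeasurableSet C := by
    have : C = Prod.fst ⁻¹' B ∩ ⋂ j,
        (fun p : ({i // i ∈ I} → Z) × ({i // ¬ i ∈ I} → Z) => (p.1, p.2 j)) ⁻¹' A := by
      ext p; simp [hC, mem_iInter]
    rw [this]
    refine (measurable_fst hB).inter (MeasurableSet.iInter fun j => ?_)
    exact (measurable_fst.prodMk ((measurable_pi_apply j).comp measurable_snd)) hA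
  have h1 := hmp.measure_preimage hCm.nullMeasurableSet
  have h2 : (MeasurableEquiv.piEquivPiSubtypeProd (fun _ : ι => Z) (· ∈ I)) ⁻¹' C =
      {s | (fun i : I => s i) ∈ B ∧ ∀ j ∉ I, ((fun i : I => s i), s j) ∈ A} := by
    ext s
    simp only [hC, mem_preimage, mem_ofPred_eq]
    refine and_congr Iff.rfl ⟨fun h j hj => h ⟨j, hj⟩, fun h j => h j j.2⟩
  rw [← h2, h1, Measure.prod_apply hCm, ← lintegral_indicator hB]
  refine lintegral_congr fun r => ?_
  by_cases hr : r ∈ B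
  · rw [indicator_of_mem hr]
    have h3 : Prod.mk r ⁻¹' C = univ.pi fun _ => {z | (r, z) ∈ A} := by
      ext q; simp [hC, hr]
    rw [h3, Measure.pi_pi, Finset.prod_const, Finset.card_univ, Fintype.card_subtype_compl]
    simp
  · rw [indicator_of_notMem hr]
    have h3 : Prod.mk r ⁻¹' C = ∅ := by
      ext q; simp [hC, hr]
    rw [h3, measure_empty]

end ProductMeasure

/-! ### The scenario bound in general position. -/

section Scenario

open MeasureTheory Set Filter Topology

variable {E Z : Type*} [NormedAddCommGroup E] [NormedSpace ℝ E] [FiniteDimensional ℝ E]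
  [MeasurableSpace E] [BorelSpace E] [MeasurableSpace Z] {J : E → ℝ} {g : E → Z → ℝ}
  {P : Measure Z} [IsProbabilityMeasure P] {τ : Z → ℝ}

/-- Sample `i` is independent of the others, and given these it must avoid only null sets: finitely
many level sets of `τ`, and the zero set of the constraint at their solution. -/
lemma ae_general_position (hP : IsConvexProgram J g) (hτ : Measurable τ)
    (hτ0 : ∀ c, P {z | τ z = c} = 0) (hnd : ∀ θ, P {z | g θ z = 0} = 0) (N : ℕ) :
    ∀ᵐ s ∂(Measure.pi fun _ : Fin N => P), Function.Injective (τ ∘ s) ∧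
      ∀ i, g (opt J g s (univ \ {i})) (s i) ≠ 0 := by
  rcases N with _ | N
  · exact Eventually.of_forall fun s => ⟨fun i => i.elim0, fun i => i.elim0⟩
  have h1 : ∀ i : Fin (N + 1), ∀ᵐ s ∂(Measure.pi fun _ : Fin (N + 1) => P),
      ∀ j : Fin N, τ (s i) ≠ τ (s (i.succAbove j)) := by
    intro i
    have hB : MeasurableSet {p : Z × (Fin N → Z) | ∃ j, τ p.1 = τ (p.2 j)} := by
      simp only [ofPred_exists]
      refine MeasurableSet.iUnion fun j => measurableSet_eq_fun (hτ.comp measurable_fst)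
        (hτ.comp ((measurable_pi_apply j).comp measurable_snd))
    have := measure_pi_null_of_section P i hB fun r => by
      have : {z | (z, r) ∈ {p : Z × (Fin N → Z) | ∃ j, τ p.1 = τ (p.2 j)}} =
          ⋃ j, {z | τ z = τ (r j)} := by ext; simp
      rw [this]
      exact measure_iUnion_null fun j => hτ0 _
    rw [ae_iff]
    convert this using 2
    ext s; simp
  have h2 : ∀ i : Fin (N + 1), ∀ᵐ s ∂(Measure.pi fun _ : Fin (N + 1) => P),
      g (opt J g s (univ \ {i})) (s i) ≠ 0 := by
    intro i
    have hB : MeasurableSet {p : Z × (Fin N → Z) | g (opt J g p.2 univ) p.1 = 0} :=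
      measurableSet_eq_fun (hP.measurable_uncurry_constraint.comp
        (((hP.measurable_opt univ).comp measurable_snd).prodMk measurable_fst)) measurable_const
    have := measure_pi_null_of_section P i hB fun r => hnd (opt J g r univ)
    rw [ae_iff]
    convert this using 2
    ext s
    have : opt J g s (univ \ {i}) = opt J g (fun j => s (i.succAbove j)) univ := by
      refine IsConvexProgram.opt_congr ?_
      change _ = (s ∘ i.succAbove) '' univ
      rw [image_comp, image_univ, Fin.range_succAbove, compl_eq_univ_sdiff]
    simp only [mem_ofPred_eq, not_not, this]
  filter_upwards [ae_all_iff.2 h1, ae_all_iff.2 h2] with s hs1 hs2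
  refine ⟨fun i j hij => ?_, hs2⟩
  by_contra hne
  obtain ⟨k, rfl⟩ := Fin.exists_succAbove_eq (Ne.symm hne)
  exact hs1 i k hij

/-- The probability of selecting the subfamily `I`, in terms of the distribution of the
probability of being dominated by `m` samples. -/
lemma measureReal_dominating (hP : IsConvexProgram J g) (hτ : Measurable τ) {m N : ℕ}
    (I : Finset (Fin N)) (hI : I.card = m) (ε : ℝ) :
    (Measure.pi fun _ : Fin N => P).real
      {s | ε < 1 - P.real (dominated J g τ fun i : I => s i) ∧
        ∀ j ∉ I, s j ∈ dominated J g τ fun i : I => s i} =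
      ∫ r in {r : Fin m → Z | ε < 1 - P.real (dominated J g τ r)},
        P.real (dominated J g τ r) ^ (N - m) ∂(Measure.pi fun _ : Fin m => P) := by
  have hmeasV : ∀ (κ : Type) [Fintype κ],
      Measurable fun r : κ → Z => P (dominated J g τ r) := fun κ _ =>
    measurable_measure_prodMk_left (measurableSet_dominated hP hτ)
  have hset : ∀ (κ : Type) [Fintype κ],
      MeasurableSet {r : κ → Z | ε < 1 - P.real (dominated J g τ r)} := fun κ _ =>
    measurableSet_lt measurable_const (measurable_const.sub (hmeasV κ).ennreal_toReal)
  have h1 := measure_pi_forall_notMem P I (measurableSet_dominated hP hτ)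
    (hset I)
  have h2 : ∫⁻ r in {r : I → Z | ε < 1 - P.real (dominated J g τ r)},
        P (dominated J g τ r) ^ (N - m) ∂(Measure.pi fun _ : I => P) =
      ∫⁻ r in {r : Fin m → Z | ε < 1 - P.real (dominated J g τ r)},
        P (dominated J g τ r) ^ (N - m) ∂(Measure.pi fun _ : Fin m => P) := by
    have e : I ≃ Fin m := Fintype.equivOfCardEq (by simp [hI])
    have hmp := measurePreserving_piCongrLeft (α := fun _ : Fin m => Z)
      (fun _ : Fin m => P) e
    have hpre : ∀ r : I → Z, dominated J g τ
        (MeasurableEquiv.piCongrLeft (fun _ : Fin m => Z) e r) = dominated J g τ r := by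
      intro r
      have := dominated_comp_equiv (J := J) (g := g) τ e.symm r
      rw [← this]
      congr 1
      ext j
      obtain ⟨i, rfl⟩ := e.surjective j
      rw [MeasurableEquiv.coe_piCongrLeft, Equiv.piCongrLeft_apply_apply]
      simp
    rw [← hmp.setLIntegral_comp_preimage (hset (Fin m)) ((hmeasV (Fin m)).pow_const _)]
    simp only [preimage_ofPred_eq, hpre]
  rw [measureReal_def, integral_eq_lintegral_of_nonneg_ae]
  · congr 1
    refine Eq.trans ?_ ((h1.trans ?_).trans (h2.trans ?_))
    · rfl
    · rw [hI, Fintype.card_fin]; rfl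
    · refine lintegral_congr fun r => ?_
      rw [ENNReal.ofReal_pow measureReal_nonneg, ofReal_measureReal]
  · exact Eventually.of_forall fun r => pow_nonneg measureReal_nonneg _
  · exact ((hmeasV (Fin m)).ennreal_toReal.pow_const _).aestronglyMeasurable

/-- The scenario theorem for programs in general position. -/
theorem measureReal_violation_le (hP : IsConvexProgram J g) (hτ : Measurable τ)
    (hτ0 : ∀ c, P {z | τ z = c} = 0) (hnd : ∀ θ, P {z | g θ z = 0} = 0)
    (hm : 1 ≤ Module.finrank ℝ E) (N : ℕ) {ε : ℝ} (hε : ε ∈ Icc (0 : ℝ) 1) :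
    (Measure.pi fun _ : Fin N => P).real {s | ε < P.real {z | g (opt J g s univ) z < 0}} ≤
      binomialTail (Module.finrank ℝ E) N ε := by
  set m := Module.finrank ℝ E with hmdef
  rcases lt_or_ge N m with hN | hN
  · rw [binomialTail_eq_one hN]
    exact measureReal_le_one
  have hmeasV : ∀ (κ : Type) [Fintype κ],
      Measurable fun r : κ → Z => P.real (dominated J g τ r) := fun κ _ =>
    (measurable_measure_prodMk_left (measurableSet_dominated hP hτ)).ennreal_toReal
  have hexu : ∀ k : ℕ, m ≤ k → ∀ᵐ s ∂(Measure.pi fun _ : Fin k => P),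
      ∃! I : Finset (Fin k), I.card = m ∧
        ∀ j ∉ I, s j ∈ dominated J g τ (fun i : I => s i) := fun k hk =>
    (ae_general_position hP hτ hτ0 hnd k).mono fun s hs =>
      existsUnique_dominating hP hs.1 hs.2 (by simpa using hk)
  have hcardI : ∀ k, ((Finset.univ : Finset (Fin k)).powersetCard m).card = k.choose m :=
    fun k => by simp
  -- The `(m+k).choose m` events that a given `m`-subset dominates are equally likely and almost
  -- surely exactly one occurs.
  have hmom : ∀ k : ℕ, ((m + k).choose m : ℝ) *
      ∫ r, (1 - (1 - P.real (dominated J g τ r))) ^ k ∂(Measure.pi fun _ : Fin m => P) = 1 := by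
    intro k
    have hI : ∀ I ∈ (Finset.univ : Finset (Fin (m + k))).powersetCard m,
        (Measure.pi fun _ : Fin (m + k) => P).real
          {s | ∀ j ∉ I, s j ∈ dominated J g τ fun i : I => s i} =
        ∫ r, (1 - (1 - P.real (dominated J g τ r))) ^ k ∂(Measure.pi fun _ : Fin m => P) := by
      intro I hI
      -- The threshold `-1` makes the condition on `1 - P.real (dominated …)` vacuous.
      have h1 := measureReal_dominating (P := P) hP hτ I (Finset.mem_powersetCard.1 hI).2 (-1)
      have h2 : ∀ x : ℝ, x ≤ 1 → -1 < 1 - x := fun x hx => by linarith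
      simp only [h2 _ measureReal_le_one, true_and, ofPred_true, Measure.restrict_univ,
        Nat.add_sub_cancel_left] at h1
      simpa using h1
    have hmeasI : ∀ I : Finset (Fin (m + k)),
        MeasurableSet {s : Fin (m + k) → Z | ∀ j ∉ I, s j ∈ dominated J g τ fun i : I => s i} := by
      intro I
      have : {s : Fin (m + k) → Z | ∀ j ∉ I, s j ∈ dominated J g τ fun i : I => s i} =
          ⋂ j, ⋂ (_ : j ∉ I), (fun s : Fin (m + k) → Z => ((fun i : I => s i), s j)) ⁻¹'
            {p | p.2 ∈ dominated J g τ p.1} := by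
        ext s; simp
      rw [this]
      refine MeasurableSet.iInter fun j => MeasurableSet.iInter fun _ => ?_
      have hr : Measurable fun s : Fin (m + k) → Z => fun i : I => s i :=
        measurable_pi_lambda _ fun i => measurable_pi_apply (i : Fin (m + k))
      exact (hr.prodMk (measurable_pi_apply j)) (measurableSet_dominated hP hτ)
    rw [← hcardI, ← nsmul_eq_mul, ← Finset.sum_const, ← Finset.sum_congr rfl hI]
    have hsum : ∑ I ∈ (Finset.univ : Finset (Fin (m + k))).powersetCard m,
        (Measure.pi fun _ : Fin (m + k) => P).real
          {s | ∀ j ∉ I, s j ∈ dominated J g τ fun i : I => s i} =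
        ∫ s, ∑ I ∈ (Finset.univ : Finset (Fin (m + k))).powersetCard m,
          indicator {s | ∀ j ∉ I, s j ∈ dominated J g τ fun i : I => s i} (fun _ => (1 : ℝ)) s
          ∂(Measure.pi fun _ : Fin (m + k) => P) := by
      rw [integral_finsetSum _ fun I _ => (integrable_const _).indicator (hmeasI I)]
      exact Finset.sum_congr rfl fun I _ => (integral_indicator_one (hmeasI I)).symm
    rw [hsum]
    have hone : ∀ᵐ s ∂(Measure.pi fun _ : Fin (m + k) => P),
        ∑ I ∈ (Finset.univ : Finset (Fin (m + k))).powersetCard m,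
          indicator {s | ∀ j ∉ I, s j ∈ dominated J g τ fun i : I => s i}
            (fun _ => (1 : ℝ)) s = 1 := by
      filter_upwards [hexu (m + k) (Nat.le_add_right m k)] with s hs
      obtain ⟨I, ⟨hI1, hI2⟩, hI3⟩ := hs
      rw [Finset.sum_eq_single I]
      · exact indicator_of_mem (by exact hI2) _
      · intro I' hI' hne
        refine indicator_of_notMem (fun h : ∀ j ∉ I', s j ∈ dominated J g τ fun i : I' => s i =>
          hne (hI3 I' ⟨(Finset.mem_powersetCard.1 hI').2, h⟩)) _
      · intro h
        exact absurd (Finset.mem_powersetCard.2 ⟨Finset.subset_univ _, hI1⟩) h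
    rw [integral_congr_ae hone]
    simp
  have hbeta := integral_pow_eq_binomialTail (W := fun r : Fin m → Z =>
    1 - P.real (dominated J g τ r)) (measurable_const.sub (hmeasV (Fin m)))
    (fun r => ⟨by linarith [measureReal_le_one (μ := P) (s := dominated J g τ r)],
      by linarith [measureReal_nonneg (μ := P) (s := dominated J g τ r)]⟩) hm hmom hN hε
  rw [← hbeta, ← hcardI, ← nsmul_eq_mul, ← Finset.sum_const]
  simp only [sub_sub_cancel]
  rw [← Finset.sum_congr rfl fun I hI =>
    measureReal_dominating (P := P) hP hτ I (Finset.mem_powersetCard.1 hI).2 ε]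
  refine le_trans ?_ (measureReal_biUnion_finset_le _ _)
  refine ENNReal.toReal_mono (measure_ne_top _ _) (measure_mono_ae ?_)
  filter_upwards [hexu N hN] with s hs hsε
  obtain ⟨I, ⟨hI1, hI2⟩, -⟩ := hs
  refine mem_biUnion (x := I) ?_ ⟨?_, hI2⟩
  · exact Finset.mem_coe.2 (Finset.mem_powersetCard.2 ⟨Finset.subset_univ _, hI1⟩)
  · have hopt : opt J g s univ = opt J g s I := by
      refine hP.opt_eq_of_subset (subset_univ _) fun j _ => ?_
      by_cases hj : j ∈ I
      · exact (hP.isArgmin_opt s (I : Set (Fin N))).1 j hj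
      · exact ((mem_dominated_restrict τ s I _).1 (hI2 j hj)).1
    have hsε' : ε < P.real {z | g (opt J g s univ) z < 0} := hsε
    refine hsε'.trans_le ?_
    have hmeas : MeasurableSet {z | g (opt J g s univ) z < 0} :=
      measurableSet_lt (hP.measurable_constraint _) measurable_const
    -- Dominated samples satisfy the constraint at the solution, so the violation probability is at
    -- most `1 - P.real (dominated …)`.
    have hsub : dominated J g τ (fun i : I => s i) ⊆ {z | g (opt J g s univ) z < 0}ᶜ := by
      intro z hz
      simp only [mem_compl_iff, mem_ofPred_eq, not_lt, hopt]
      exact ((mem_dominated_restrict τ s I z).1 hz).1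
    have h1 := measureReal_mono (μ := P) hsub
    rw [probReal_compl_eq_one_sub hmeas] at h1
    linarith

end Scenario

/-! ### Removing nondegeneracy by regularization. -/

section Limit

open MeasureTheory Set Filter Topology

/-- Lower semicontinuity of measures of sets. -/
lemma eventually_lt_measure {Ω : Type*} [MeasurableSpace Ω] {μ : Measure Ω} {S : Set Ω}
    {T : ℕ → Set Ω} (h : ∀ ω ∈ S, ∀ᶠ k in atTop, ω ∈ T k) {a : ENNReal} (ha : a < μ S) :
    ∀ᶠ k in atTop, a < μ (T k) := by
  have hmono : Monotone fun K => S ∩ ⋂ k ≥ K, T k := fun K L hKL =>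
    inter_subset_inter_right _ (biInter_subset_biInter_left fun k hk => hKL.trans hk)
  have hunion : ⋃ K, (S ∩ ⋂ k ≥ K, T k) = S := by
    refine subset_antisymm (iUnion_subset fun K => inter_subset_left) fun ω hω => ?_
    obtain ⟨K, hK⟩ := eventually_atTop.1 (h ω hω)
    exact mem_iUnion.2 ⟨K, hω, mem_iInter₂.2 hK⟩
  have hlim := tendsto_measure_iUnion_atTop (μ := μ) hmono
  rw [hunion] at hlim
  obtain ⟨K, hK⟩ := (hlim.eventually (lt_mem_nhds ha)).exists
  filter_upwards [eventually_ge_atTop K] with k hk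
  exact hK.trans_le (measure_mono (inter_subset_right.trans (biInter_subset_of_mem hk)))

variable {E Z : Type*} [NormedAddCommGroup E] [InnerProductSpace ℝ E]

lemma strictConvexOn_sq_norm : StrictConvexOn ℝ univ fun θ : E => ‖θ‖ ^ 2 := by
  refine ⟨convex_univ, fun x _ y _ hxy a b ha hb hab => ?_⟩
  have h : a * ‖x‖ ^ 2 + b * ‖y‖ ^ 2 - ‖a • x + b • y‖ ^ 2 = a * b * ‖x - y‖ ^ 2 := by
    rw [norm_add_sq_real, norm_sub_sq_real, norm_smul, norm_smul, inner_smul_left,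
      inner_smul_right, Real.norm_of_nonneg ha.le, Real.norm_of_nonneg hb.le]
    obtain rfl : b = 1 - a := by linarith
    simp
    ring
  have hpos : 0 < a * b * ‖x - y‖ ^ 2 := by
    have := norm_pos_iff.2 (sub_ne_zero.2 hxy)
    positivity
  simp only [smul_eq_mul]
  linarith

/-- The linear objective `c`, regularized by the tie-break function `t`. -/
noncomputable def regularized (c : E →L[ℝ] ℝ) (t : E → ℝ) (l : ℝ) (θ : E) : ℝ :=
  c θ + l * Real.exp (t θ) + l ^ 2 * ‖θ‖ ^ 2

/-- The constraint, relaxed in terms of a tag. -/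
def relaxed (g : E → Z → ℝ) (l : ℝ) (θ : E) (z : Z × unitInterval) : ℝ :=
  g θ z.1 + l ^ 2 * (z.2 : ℝ)

lemma convexOn_exp_comp {t : E → ℝ} (ht : ConvexOn ℝ univ t) :
    ConvexOn ℝ univ fun θ => Real.exp (t θ) := by
  refine ⟨convex_univ, fun x _ y _ a b ha hb hab => ?_⟩
  exact (Real.exp_le_exp.2 (ht.2 (mem_univ x) (mem_univ y) ha hb hab)).trans
    (convexOn_exp.2 (mem_univ _) (mem_univ _) ha hb hab)

lemma continuous_of_convexOn [FiniteDimensional ℝ E] {t : E → ℝ} (ht : ConvexOn ℝ univ t) :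
    Continuous t :=
  continuousOn_univ.1 (ht.continuousOn isOpen_univ)

lemma isConvexProgram_regularized [FiniteDimensional ℝ E] [MeasurableSpace Z]
    (c : E →L[ℝ] ℝ) {t : E → ℝ}
    (ht : ConvexOn ℝ univ t) {g : E → Z → ℝ} (hconc : ∀ z, ConcaveOn ℝ univ fun θ => g θ z)
    (hmeas : ∀ θ, Measurable (g θ)) (hfeas : ∃ θ, ∀ z, 0 ≤ g θ z) {l : ℝ} (hl : 0 < l) :
    IsConvexProgram (regularized c t l) (relaxed g l) := by
  have hcont : Continuous (regularized c t l) := by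
    have := continuous_of_convexOn ht
    unfold regularized
    fun_prop
  have hgcont : ∀ z, Continuous fun θ => g θ z := fun z => by
    have := (continuous_of_convexOn (hconc z).neg).neg
    simpa using this
  refine ⟨?_, hcont, fun r => ?_, fun z => ?_, fun z => ?_, fun θ => ?_, ?_⟩
  · have h1 : ConvexOn ℝ univ fun θ => c θ := c.toLinearMap.convexOn convex_univ
    have h2 := (convexOn_exp_comp ht).smul hl.le
    refine (h1.add h2).add_strictConvexOn ?_
    refine ⟨convex_univ, fun x _ y _ hxy a b ha hb hab => ?_⟩
    have := strictConvexOn_sq_norm.2 (mem_univ x) (mem_univ y) hxy ha hb hab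
    simp only [smul_eq_mul] at this ⊢
    have := mul_lt_mul_of_pos_left this (pow_pos hl 2)
    linarith
  · have := FiniteDimensional.proper_real E
    refine Metric.isCompact_of_isClosed_isBounded (isClosed_le hcont continuous_const) ?_
    -- Outside this ball, `l²‖θ‖² - ‖c‖‖θ‖ > (|r| + 1)‖θ‖ > r`, and the exponential term is
    -- positive.
    refine (Metric.isBounded_closedBall (x := (0 : E))
      (r := max 1 ((|r| + ‖c‖ + 1) / l ^ 2))).subset fun θ hθ => ?_
    rw [mem_closedBall_zero_iff]
    by_contra! hlt
    obtain ⟨h1, h2⟩ := max_lt_iff.1 hlt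
    rw [div_lt_iff₀ (pow_pos hl 2)] at h2
    have h3 : regularized c t l θ ≤ r := hθ
    unfold regularized at h3
    have h4 := abs_le.1 (c.le_opNorm θ)
    have h5 : 0 < l * Real.exp (t θ) := by positivity
    have h6 := le_abs_self r
    have h7 := abs_nonneg r
    nlinarith [mul_lt_mul_of_pos_right h2 (by linarith : 0 < ‖θ‖)]
  · exact (hconc z.1).add_const _
  · exact (hgcont z.1).add continuous_const
  · exact ((hmeas θ).comp measurable_fst).add
      (measurable_const.mul (measurable_subtype_coe.comp measurable_snd))
  · obtain ⟨θ, hθ⟩ := hfeas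
    refine ⟨θ, fun z => add_nonneg (hθ _) ?_⟩
    have := z.2.2.1
    positivity

/-- `θ` is the solution of the program with linear objective `c` singled out by `t`. -/
def IsSelected (c : E →L[ℝ] ℝ) (t : E → ℝ) (C : Set E) (θ : E) : Prop :=
  θ ∈ C ∧ (∀ θ' ∈ C, c θ ≤ c θ') ∧ ∀ θ' ∈ C, c θ' = c θ → θ' ≠ θ → t θ < t θ'

/-- The selected solution is the only common solution of the convex inequalities `c ≤ c θ`, `exp t ≤
exp (t θ)`, `-g ≤ 0`, so `exists_modulus` reduces convergence to approximate validity of these.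
Relaxing the constraints changes the optimal value of `c` by only `O(l²)`, which is negligible
against the weight `l` of the tie-break. Replacing `t` by `exp t` keeps its order and convexity and
bounds it below. -/
lemma tendsto_opt_regularized [FiniteDimensional ℝ E] [MeasurableSpace Z] {ι : Type*}
    (c : E →L[ℝ] ℝ) {t : E → ℝ}
    (ht : ConvexOn ℝ univ t) {g : E → Z → ℝ} (hconc : ∀ z, ConcaveOn ℝ univ fun θ => g θ z)
    (hmeas : ∀ θ, Measurable (g θ)) (hfeas : ∃ θ, ∀ z, 0 ≤ g θ z) {e : E}
    (he : ∀ r, 0 ≤ r → ∀ θ z, g θ z + r ≤ g (θ + r • e) z) (s : ι → Z × unitInterval)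
    {θ : E} (hθ : IsSelected c t (feasibleSet g (fun i => (s i).1) univ) θ)
    {l : ℕ → ℝ} (hl : ∀ k, 0 < l k) (hlim : Tendsto l atTop (𝓝 0)) :
    Tendsto (fun k => opt (regularized c t (l k)) (relaxed g (l k)) s univ) atTop (𝓝 θ) := by
  have htc := continuous_of_convexOn ht
  have hgcont : ∀ z, Continuous fun θ => g θ z := fun z => by
    have := (continuous_of_convexOn (hconc z).neg).neg
    simpa using this
  let φ : Bool ⊕ ι → E → ℝ := Sum.elim
    (fun b => bif b then fun θ' => c θ' - c θ else fun θ' => Real.exp (t θ') - Real.exp (t θ))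
    (fun i θ' => - g θ' (s i).1)
  have hφconv : ∀ j, ConvexOn ℝ univ (φ j) := by
    rintro ((_ | _) | i)
    · exact (convexOn_exp_comp ht).add_const (-Real.exp (t θ))
    · exact (c.toLinearMap.convexOn convex_univ).add_const (-c θ)
    · exact (hconc _).neg
  have hφcont : ∀ j, Continuous (φ j) := by
    rintro ((_ | _) | i)
    · exact (Real.continuous_exp.comp htc).sub continuous_const
    · exact c.continuous.sub continuous_const
    · exact (hgcont _).neg
  have hφ0 : ∀ j, φ j θ ≤ 0 := by
    rintro ((_ | _) | i)
    · simp [φ]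
    · simp [φ]
    · have := hθ.1 i (mem_univ i)
      simpa [φ] using this
  have huniq : ∀ θ', θ' ≠ θ → ∃ j, 0 < φ j θ' := by
    intro θ' hne
    by_contra! hcon
    have hf : θ' ∈ feasibleSet g (fun i => (s i).1) univ := fun i _ => by
      simpa [φ] using hcon (Sum.inr i)
    have h1 : c θ' ≤ c θ := by simpa [φ] using hcon (Sum.inl true)
    have h2 : t θ' ≤ t θ := by simpa [φ] using hcon (Sum.inl false)
    exact absurd (hθ.2.2 θ' hf (le_antisymm h1 (hθ.2.1 θ' hf)) hne) (not_lt.2 h2)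
  rw [Metric.tendsto_nhds]
  intro ρ hρ
  obtain ⟨κ, hκ, hmod⟩ := exists_modulus hφconv hφcont hφ0 huniq hρ
  have e1 : Tendsto (fun k => l k * Real.exp (t θ) + l k ^ 2 * ‖θ‖ ^ 2) atTop (𝓝 0) := by
    have := (hlim.mul_const (Real.exp (t θ))).add ((hlim.pow 2).mul_const (‖θ‖ ^ 2))
    simpa using this
  have e2 : Tendsto (fun k => l k * (‖θ‖ ^ 2 + c e)) atTop (𝓝 0) := by
    simpa using hlim.mul_const (‖θ‖ ^ 2 + c e)
  have e3 : Tendsto (fun k => l k ^ 2) atTop (𝓝 0) := by simpa using hlim.pow 2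
  filter_upwards [e1.eventually (gt_mem_nhds hκ), e2.eventually (gt_mem_nhds hκ),
    e3.eventually (gt_mem_nhds hκ)] with k h1 h2 h3
  rw [dist_eq_norm]
  have hlk := hl k
  have hopt := (isConvexProgram_regularized c ht hconc hmeas hfeas hlk).isArgmin_opt s univ
  set θk := opt (regularized c t (l k)) (relaxed g (l k)) s univ
  have hJ := hopt.2 θ fun i _ => by
    have := (s i).2.2.1
    have h' := hθ.1 i (mem_univ i)
    unfold relaxed
    positivity
  -- A shift by `l²` in the direction `e` repairs the relaxation, at cost `l² c e`.
  have hlow : c θ ≤ c θk + l k ^ 2 * c e := by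
    have := hθ.2.1 (θk + l k ^ 2 • e) fun i _ => by
      have h4 := he (l k ^ 2) (by positivity) θk (s i).1
      have h5 := hopt.1 i (mem_univ i)
      unfold relaxed at h5
      have h6 : l k ^ 2 * ((s i).2 : ℝ) ≤ l k ^ 2 :=
        mul_le_of_le_one_right (by positivity) (s i).2.2.2
      linarith
    simpa using this
  unfold regularized at hJ
  have hq : 0 ≤ l k ^ 2 * ‖θk‖ ^ 2 := by positivity
  refine hmod θk ?_
  rintro ((_ | _) | i)
  · change Real.exp (t θk) - Real.exp (t θ) < κ
    refine lt_of_le_of_lt ?_ h2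
    refine le_of_mul_le_mul_left ?_ hlk
    nlinarith
  · change c θk - c θ < κ
    have : 0 < l k * Real.exp (t θk) := by positivity
    linarith
  · change - g θk (s i).1 < κ
    have h5 := hopt.1 i (mem_univ i)
    unfold relaxed at h5
    have h6 : l k ^ 2 * ((s i).2 : ℝ) ≤ l k ^ 2 :=
      mul_le_of_le_one_right (by positivity) (s i).2.2.2
    linarith

/-- The scenario theorem: with probability at least `1 - ∑_{k < m} (N choose k) ε^k (1-ε)^{N-k}`, the
selected solution of the scenario program violates the constraints with probability less than `ε`,
whenever it exists. -/
theorem exists_measurableSet_violation_lt [FiniteDimensional ℝ E] [MeasurableSpace E] [BorelSpace E]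
    [MeasurableSpace Z] {P : Measure Z} [IsProbabilityMeasure P]
    (hm : 1 ≤ Module.finrank ℝ E) (c : E →L[ℝ] ℝ) {t : E → ℝ}
    (ht : ConvexOn ℝ univ t) {g : E → Z → ℝ} (hconc : ∀ z, ConcaveOn ℝ univ fun θ => g θ z)
    (hmeas : ∀ θ, Measurable (g θ)) (hfeas : ∃ θ, ∀ z, 0 ≤ g θ z) {e : E}
    (he : ∀ r, 0 ≤ r → ∀ θ z, g θ z + r ≤ g (θ + r • e) z) (N : ℕ) {ε : ℝ}
    (hε : ε ∈ Ioo (0 : ℝ) 1) :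
    ∃ G : Set (Fin N → Z), MeasurableSet G ∧
      1 - binomialTail (Module.finrank ℝ E) N ε ≤ (Measure.pi fun _ : Fin N => P).real G ∧
      ∀ s ∈ G, ∀ θ, IsSelected c t (feasibleSet g s univ) θ → P.real {z | g θ z < 0} < ε := by
  set A : Set (Fin N → Z) :=
    {s | ∃ θ, IsSelected c t (feasibleSet g s univ) θ ∧ ε ≤ P.real {z | g θ z < 0}} with hA
  set m := Module.finrank ℝ E
  let P' : Measure (Z × unitInterval) := P.prod volume
  let l : ℕ → ℝ := fun k => 1 / ((k : ℝ) + 1)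
  have hl : ∀ k, 0 < l k := fun k => Nat.one_div_pos_of_nat
  have hlim : Tendsto l atTop (𝓝 0) := tendsto_one_div_add_atTop_nhds_zero_nat
  have hgcont : ∀ z, Continuous fun θ => g θ z := fun z => by
    have := (continuous_of_convexOn (hconc z).neg).neg
    simpa using this
  have hprog := fun k => isConvexProgram_regularized c ht hconc hmeas hfeas (hl k)
  -- The limit argument preserves only strict inequalities, hence the slightly smaller `ε'`;
  -- continuity of the tail then lets `ε' → ε`.
  have hbound : ∀ ε' ∈ Ioo 0 ε,
      Measure.pi (fun _ : Fin N => P) A ≤ ENNReal.ofReal (binomialTail m N ε') := by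
    intro ε' hε'
    let B : ℕ → Set (Fin N → Z × unitInterval) := fun k =>
      {s | ε' < P'.real {z | relaxed g (l k)
        (opt (regularized c t (l k)) (relaxed g (l k)) s univ) z < 0}}
    have hB : ∀ k, Measure.pi (fun _ : Fin N => P') (B k) ≤
        ENNReal.ofReal (binomialTail m N ε') := by
      intro k
      rw [← ofReal_measureReal]
      refine ENNReal.ofReal_le_ofReal ?_
      refine measureReal_violation_le (τ := fun z : Z × unitInterval => (z.2 : ℝ)) (hprog k)
        (measurable_subtype_coe.comp measurable_snd) (fun r => ?_) (fun θ => ?_) hm N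
        ⟨hε'.1.le, (hε'.2.trans hε.2).le⟩
      · have hset : {z : Z × unitInterval | (z.2 : ℝ) = r} =
            univ ×ˢ {u : unitInterval | (u : ℝ) = r} := by ext; simp
        rw [hset, Measure.prod_prod]
        have : {u : unitInterval | (u : ℝ) = r}.Subsingleton := fun u hu v hv =>
          Subtype.ext (Eq.trans hu (Eq.symm hv))
        rw [this.measure_zero, mul_zero]
      · have hms : MeasurableSet {z : Z × unitInterval | relaxed g (l k) θ z = 0} :=
          measurableSet_eq_fun ((hprog k).measurable_constraint θ) measurable_const
        rw [Measure.measure_prod_null hms]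
        -- For fixed `z`, the relaxed constraint vanishes for at most one value of the uniform tag.
        refine Eventually.of_forall fun z => ?_
        refine Set.Subsingleton.measure_zero (fun u hu v hv => Subtype.ext ?_) _
        have hu' : g θ z + l k ^ 2 * (u : ℝ) = 0 := hu
        have hv' : g θ z + l k ^ 2 * (v : ℝ) = 0 := hv
        exact mul_left_cancel₀ (pow_pos (hl k) 2).ne' (by linarith)
    have hproj : Measure.pi (fun _ : Fin N => P') {s | (fun i => (s i).1) ∈ A} =
        Measure.pi (fun _ : Fin N => P) A := by
      have hmp := measurePreserving_arrowProdEquivProdArrow Z unitInterval (Fin N)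
        (fun _ => P) (fun _ => volume)
      have h1 := hmp.measure_preimage_equiv (A ×ˢ univ)
      rw [Measure.prod_prod, measure_univ, mul_one] at h1
      rw [← h1]
      congr 1
      ext s
      simp [MeasurableEquiv.arrowProdEquivProdArrow, Equiv.arrowProdEquivProdArrow]
    rw [← hproj]
    by_contra! hlt
    have hev : ∀ s ∈ {s : Fin N → Z × unitInterval | (fun i => (s i).1) ∈ A},
        ∀ᶠ k in atTop, s ∈ B k := by
      rintro s ⟨θ, hθ, hεθ⟩
      have hconv := tendsto_opt_regularized c ht hconc hmeas hfeas he s hθ hl hlim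
      have h1 : ∀ z ∈ {z : Z × unitInterval | g θ z.1 < 0}, ∀ᶠ k in atTop,
          z ∈ {z | relaxed g (l k) (opt (regularized c t (l k)) (relaxed g (l k)) s univ) z < 0} := by
        intro z hz
        have h2 : Tendsto (fun k => relaxed g (l k)
            (opt (regularized c t (l k)) (relaxed g (l k)) s univ) z) atTop (𝓝 (g θ z.1)) := by
          have h3 := (((hgcont z.1).tendsto θ).comp hconv).add ((hlim.pow 2).mul_const (z.2 : ℝ))
          rw [zero_pow two_ne_zero, zero_mul, add_zero] at h3
          exact h3
        exact h2.eventually (gt_mem_nhds hz)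
      have h4 : P' {z | g θ z.1 < 0} = P {z | g θ z < 0} := by
        have hset : {z : Z × unitInterval | g θ z.1 < 0} = {z | g θ z < 0} ×ˢ univ := by ext; simp
        rw [hset, Measure.prod_prod, measure_univ, mul_one]
      have h5 : ENNReal.ofReal ε' < P' {z | g θ z.1 < 0} := by
        rw [h4, ← ofReal_measureReal]
        exact (ENNReal.ofReal_lt_ofReal_iff_of_nonneg hε'.1.le).2 (hε'.2.trans_le hεθ)
      filter_upwards [eventually_lt_measure h1 h5] with k hk
      exact (ENNReal.ofReal_lt_iff_lt_toReal hε'.1.le (measure_ne_top _ _)).1 hk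
    obtain ⟨k, hk⟩ := (eventually_lt_measure hev hlt).exists
    exact absurd (hB k) (not_le.2 hk)
  have hAε : Measure.pi (fun _ : Fin N => P) A ≤ ENNReal.ofReal (binomialTail m N ε) := by
    have hc : Tendsto (fun ε' => ENNReal.ofReal (binomialTail m N ε')) (𝓝[<] ε)
        (𝓝 (ENNReal.ofReal (binomialTail m N ε))) :=
      ((ENNReal.continuous_ofReal.comp (continuous_binomialTail m N)).tendsto ε).mono_left
        nhdsWithin_le_nhds
    refine ge_of_tendsto hc ?_
    filter_upwards [Ioo_mem_nhdsLT hε.1] with ε' h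
    exact hbound ε' h
  -- Measurability of `A` is not needed: `G` is the complement of a measurable hull with the same
  -- measure.
  refine ⟨(toMeasurable (Measure.pi fun _ : Fin N => P) A)ᶜ,
    (measurableSet_toMeasurable _ _).compl, ?_, ?_⟩
  · rw [probReal_compl_eq_one_sub (measurableSet_toMeasurable _ _), measureReal_def,
      measure_toMeasurable]
    have hnn : 0 ≤ binomialTail m N ε := Finset.sum_nonneg fun k _ => by
      have := hε.1
      have := sub_pos.2 hε.2
      positivity
    linarith [ENNReal.toReal_le_of_le_ofReal hnn hAε]
  · intro s hs θ hθ
    by_contra! hcon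
    exact hs (subset_toMeasurable _ _ ⟨θ, hθ, hcon⟩)

end Limit

/-! ### The SOS program as a scenario program. -/

section Application

open MeasureTheory Set Filter Topology

variable {n dx dy dg : ℕ}

lemma pVal_eq (θ : Decision n dx dy dg) (x : Fin n → ℝ) (y : ℝ) :
    pVal θ x y = ∑ k : Fin dy, MvPolynomial.eval x (θ.1 k : MvPolynomial (Fin n) ℝ) *
      y ^ ((k : ℕ) + 1) := by
  simp [pVal, pPoly, Polynomial.eval_finsetSum]

lemma pVal_add (θ θ' : Decision n dx dy dg) (x : Fin n → ℝ) (y : ℝ) :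
    pVal (θ + θ') x y = pVal θ x y + pVal θ' x y := by
  simp [pVal_eq, add_mul, Finset.sum_add_distrib]

lemma pVal_smul (r : ℝ) (θ : Decision n dx dy dg) (x : Fin n → ℝ) (y : ℝ) :
    pVal (r • θ) x y = r * pVal θ x y := by
  simp [pVal_eq, Finset.mul_sum, mul_assoc]

lemma gammaVal_add (θ θ' : Decision n dx dy dg) (x : Fin n → ℝ) (y : ℝ) :
    gammaVal (θ + θ') x y = gammaVal θ x y + gammaVal θ' x y := by
  simp [gammaVal, evalXY]

lemma gammaVal_smul (r : ℝ) (θ : Decision n dx dy dg) (x : Fin n → ℝ) (y : ℝ) :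
    gammaVal (r • θ) x y = r * gammaVal θ x y := by
  simp [gammaVal, evalXY, MvPolynomial.smul_eval]

/-- The decision with `p = 0` and `γ = 1`. -/
noncomputable def constDecision : Decision n dx dy dg :=
  (0, ⟨1, by simp [MvPolynomial.mem_restrictTotalDegree]⟩)

lemma pVal_constDecision (x : Fin n → ℝ) (y : ℝ) :
    pVal (constDecision : Decision n dx dy dg) x y = 0 := by
  simp [pVal_eq, constDecision]

lemma gammaVal_constDecision (x : Fin n → ℝ) (y : ℝ) :
    gammaVal (constDecision : Decision n dx dy dg) x y = 1 := by
  simp [gammaVal, evalXY, constDecision]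

lemma one_le_numVars : 1 ≤ numVars n dx dy dg := by
  have : Nontrivial (Decision n dx dy dg) :=
    ⟨constDecision, 0, fun h => by
      have := gammaVal_constDecision (dx := dx) (dy := dy) (dg := dg) (0 : Fin n → ℝ) 0
      rw [h] at this
      simp [gammaVal, evalXY] at this⟩
  exact Module.finrank_pos

lemma eval_slackPoly (α : ℝ) (θ : Decision n dx dy dg) (x : Fin n → ℝ) (y₀ y : ℝ) :
    (slackPoly α θ x y₀).eval y =
      pVal θ x y - pVal θ x y₀ + gammaVal θ x y₀ - α * (y - y₀) ^ 2 := by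
  simp [slackPoly, pVal]

lemma natDegree_slackPoly_le (α : ℝ) (θ : Decision n dx dy dg) (x : Fin n → ℝ) (y₀ : ℝ) :
    (slackPoly α θ x y₀).natDegree ≤ max dy 2 := by
  have h1 : (pPoly θ x).natDegree ≤ dy := by
    refine Polynomial.natDegree_sum_le_of_forall_le _ _ fun k _ => ?_
    exact (Polynomial.natDegree_C_mul_X_pow_le _ _).trans k.2
  have h2 : (Polynomial.C α * (Polynomial.X - Polynomial.C y₀) ^ 2).natDegree ≤ 2 := by
    refine (Polynomial.natDegree_C_mul_le _ _).trans ?_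
    refine Polynomial.natDegree_pow_le.trans ?_
    simp
  unfold slackPoly
  refine (Polynomial.natDegree_sub_le _ _).trans (max_le ?_ (le_trans h2 (le_max_right _ _)))
  rw [Polynomial.natDegree_add_C, Polynomial.natDegree_sub_C]
  exact h1.trans (le_max_left _ _)

/-- The projection to `[a, b]`. -/
noncomputable def clamp (a b y : ℝ) : ℝ := max a (min b y)

lemma clamp_mem {a b : ℝ} (hab : a ≤ b) (y : ℝ) : clamp a b y ∈ Icc a b :=
  ⟨le_max_left _ _, max_le hab (min_le_left _ _)⟩

lemma clamp_of_mem {a b y : ℝ} (hy : y ∈ Icc a b) : clamp a b y = y := by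
  rw [clamp, min_eq_right hy.2, max_eq_right hy.1]

lemma continuous_clamp (a b : ℝ) : Continuous (clamp a b) := by
  unfold clamp
  fun_prop

/-- The scalar form of the constraint at `x`: the minimum over `y ∈ [a, b]` of
`p(x, y) - p(x, f(x)) + γ(x, f(x)) - α (y - f(x))²`, where `f` is clamped to `[a, b]`. -/
noncomputable def minSlack (a b α : ℝ) (f : (Fin n → ℝ) → ℝ) (θ : Decision n dx dy dg)
    (x : Fin n → ℝ) : ℝ :=
  -- Rational points suffice by continuity, and a countable infimum is measurable in `x`. Clamping
  -- `f` keeps the constraints jointly satisfiable even for `x` outside `X`.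
  ⨅ q : ℚ, (slackPoly α θ x (clamp a b (f x))).eval (clamp a b q)

variable {a b α : ℝ} {f : (Fin n → ℝ) → ℝ}

lemma minSlack_le (hab : a ≤ b) (θ : Decision n dx dy dg) (x : Fin n → ℝ) (q : ℚ) :
    minSlack a b α f θ x ≤ (slackPoly α θ x (clamp a b (f x))).eval (clamp a b q) := by
  refine ciInf_le ?_ q
  refine ((isCompact_Icc (a := a) (b := b)).bddBelow_image
    (slackPoly α θ x (clamp a b (f x))).continuous.continuousOn).mono ?_
  rintro _ ⟨q, rfl⟩
  exact ⟨_, clamp_mem hab _, rfl⟩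

lemma minSlack_nonneg_iff (hab : a ≤ b) (θ : Decision n dx dy dg) (x : Fin n → ℝ) :
    0 ≤ minSlack a b α f θ x ↔
      ∀ y ∈ Icc a b, 0 ≤ (slackPoly α θ x (clamp a b (f x))).eval y := by
  constructor
  · intro h y hy
    have hcl : IsClosed {y | 0 ≤ (slackPoly α θ x (clamp a b (f x))).eval (clamp a b y)} :=
      isClosed_le continuous_const
        ((slackPoly α θ x (clamp a b (f x))).continuous.comp (continuous_clamp a b))
    have hsub : range ((↑) : ℚ → ℝ) ⊆
        {y | 0 ≤ (slackPoly α θ x (clamp a b (f x))).eval (clamp a b y)} := by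
      rintro _ ⟨q, rfl⟩
      exact h.trans (minSlack_le hab θ x q)
    have hall := hcl.closure_subset_iff.2 hsub
    have hy' := hall (Rat.denseRange_cast y)
    rwa [mem_ofPred_eq, clamp_of_mem hy] at hy'
  · exact fun h => le_ciInf fun q => h _ (clamp_mem hab _)

lemma minSlack_concave (hab : a ≤ b) {θ θ' : Decision n dx dy dg} {r r' : ℝ} (hr : 0 ≤ r)
    (hr' : 0 ≤ r') (hrr : r + r' = 1) (x : Fin n → ℝ) :
    r * minSlack a b α f θ x + r' * minSlack a b α f θ' x ≤
      minSlack a b α f (r • θ + r' • θ') x := by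
  refine le_ciInf fun q => ?_
  have h1 := mul_le_mul_of_nonneg_left (minSlack_le (α := α) (f := f) hab θ x q) hr
  have h2 := mul_le_mul_of_nonneg_left (minSlack_le (α := α) (f := f) hab θ' x q) hr'
  refine (add_le_add h1 h2).trans (le_of_eq ?_)
  simp only [eval_slackPoly, pVal_add, pVal_smul, gammaVal_add, gammaVal_smul]
  obtain rfl : r' = 1 - r := by linarith
  ring

/-- Raising `γ` by a constant raises every slack; this provides the direction `e` of the scenario
theorem. -/
lemma minSlack_add_const (hab : a ≤ b) (θ : Decision n dx dy dg) (r : ℝ) (x : Fin n → ℝ) :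
    minSlack a b α f θ x + r ≤ minSlack a b α f (θ + r • constDecision) x := by
  refine le_ciInf fun q => ?_
  have h1 := minSlack_le (α := α) (f := f) hab θ x q
  simp only [eval_slackPoly, pVal_add, pVal_smul, gammaVal_add, gammaVal_smul,
    pVal_constDecision, gammaVal_constDecision] at h1 ⊢
  linarith

lemma exists_minSlack_nonneg (hab : a ≤ b) (hα : 0 ≤ α) :
    ∃ θ : Decision n dx dy dg, ∀ x, 0 ≤ minSlack a b α f θ x := by
  refine ⟨(α * (b - a) ^ 2) • constDecision, fun x => (minSlack_nonneg_iff hab _ x).2 ?_⟩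
  intro y hy
  have hc := clamp_mem hab (f x)
  simp only [eval_slackPoly, pVal_smul, gammaVal_smul, pVal_constDecision, gammaVal_constDecision]
  have : (y - clamp a b (f x)) ^ 2 ≤ (b - a) ^ 2 := by
    refine sq_le_sq' ?_ ?_ <;> linarith [hy.1, hy.2, hc.1, hc.2]
  nlinarith

lemma measurable_minSlack (hf : Measurable f) (θ : Decision n dx dy dg) :
    Measurable (minSlack a b α f θ) := by
  have hfc : Measurable fun x => clamp a b (f x) := (continuous_clamp a b).measurable.comp hf
  have hev : ∀ p : MvPolynomial (Fin n) ℝ, Measurable fun x => MvPolynomial.eval x p :=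
    fun p => (MvPolynomial.continuous_eval p).measurable
  have hp : ∀ v : (Fin n → ℝ) → ℝ, Measurable v → Measurable fun x => pVal θ x (v x) := by
    intro v hv
    simp only [pVal_eq]
    exact Finset.measurable_sum _ fun k _ => (hev _).mul (hv.pow_const _)
  have hg : Measurable fun x => gammaVal θ x (clamp a b (f x)) := by
    unfold gammaVal evalXY
    refine (MvPolynomial.continuous_eval _).measurable.comp (measurable_pi_lambda _ ?_)
    rintro (i | i)
    · exact measurable_pi_apply i
    · exact hfc
  refine Measurable.iInf fun q => ?_
  simp only [eval_slackPoly]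
  exact (((hp _ measurable_const).sub (hp _ hfc)).add hg).sub
    (measurable_const.mul ((measurable_const.sub hfc).pow_const 2))

lemma feasible_iff (hab : a < b) {N : ℕ} {s : Fin N → Fin n → ℝ} (hs : ∀ i, f (s i) ∈ Icc a b)
    (θ : Decision n dx dy dg) :
    Feasible a b α f s θ ↔ ∀ i, 0 ≤ minSlack a b α f θ (s i) := by
  refine forall_congr' fun i => ?_
  rw [minSlack_nonneg_iff hab.le, clamp_of_mem (hs i),
    sosCertificate_iff hab (le_max_right _ _) (natDegree_slackPoly_le _ _ _ _)]
  -- At `y = y_i` the slack equals `γ(x_i, y_i)`, so the sign constraint on `γ` is redundant.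
  refine and_iff_left_of_imp fun h => ?_
  simpa [eval_slackPoly] using h _ (hs i)

/-- The objective as a linear functional. -/
noncomputable def objectiveLinear (X : Set (Fin n → ℝ)) (a b : ℝ)
    (hint : ∀ p ∈ MvPolynomial.restrictTotalDegree (Fin n ⊕ Unit) ℝ dg,
      IntegrableOn (fun z : (Fin n → ℝ) × ℝ => evalXY p z.1 z.2) (X ×ˢ Icc a b)) :
    Decision n dx dy dg →ₗ[ℝ] ℝ where
  toFun := objective X a b
  map_add' θ θ' := by
    simp only [objective, gammaVal_add]
    exact integral_add (hint _ θ.2.2) (hint _ θ'.2.2)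
  map_smul' r θ := by
    simp only [objective, gammaVal_smul, integral_const_mul]
    rfl

/-- The guarantee for the argmin selection at a point where the constraint holds. -/
lemma abs_sub_le_sqrt_of_minSlack_nonneg (hab : a ≤ b) (hα : 0 < α) {X : Set (Fin n → ℝ)}
    {θ : Decision n dx dy dg} {γmax : ℝ}
    (hγ : γmax ∈ upperBounds ((fun z : (Fin n → ℝ) × ℝ => gammaVal θ z.1 z.2) '' (X ×ˢ Icc a b)))
    {fhat : (Fin n → ℝ) → ℝ} (hfhat : IsArgminSelection X a b θ fhat) {x : Fin n → ℝ}
    (hx : x ∈ X) (hfx : f x ∈ Icc a b) (h : 0 ≤ minSlack a b α f θ x) :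
    |fhat x - f x| ≤ Real.sqrt (γmax / α) := by
  obtain ⟨hmem, hmin⟩ := hfhat.2 x hx
  have h1 := (minSlack_nonneg_iff hab θ x).1 h _ hmem
  rw [clamp_of_mem hfx, eval_slackPoly] at h1
  have h2 := hmin _ hfx
  have h3 : gammaVal θ x (f x) ≤ γmax := hγ ⟨(x, f x), ⟨hx, hfx⟩, rfl⟩
  refine Real.abs_le_sqrt ?_
  rw [le_div_iff₀ hα]
  linarith

/-- The guarantee for the sampled program, in terms of the binomial tail. -/
theorem exists_measurableSet_abs_sub_le {N : ℕ} {ε δ : ℝ} (hab : a ≤ b) (hα : 0 < α)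
    (hε : ε ∈ Ioo (0 : ℝ) 1) (hδ : δ ∈ Ioo (0 : ℝ) 1) {X : Set (Fin n → ℝ)} (hX : MeasurableSet X)
    (hint : ∀ p ∈ MvPolynomial.restrictTotalDegree (Fin n ⊕ Unit) ℝ dg,
      IntegrableOn (fun z : (Fin n → ℝ) × ℝ => evalXY p z.1 z.2) (X ×ˢ Icc a b))
    (hf : Measurable f) (hfX : ∀ x ∈ X, f x ∈ Icc a b)
    (P : Measure (Fin n → ℝ)) [IsProbabilityMeasure P] (hP : ∀ᵐ x ∂P, x ∈ X)
    {t : Decision n dx dy dg → ℝ} (ht : ConvexOn ℝ univ t)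
    (hcond : binomialTail (numVars n dx dy dg) N ε ≤ δ) :
    ∃ G : Set (Fin N → Fin n → ℝ), MeasurableSet G ∧
      1 - δ ≤ (Measure.pi (fun _ : Fin N => P)).real G ∧
      ∀ s ∈ G, ∀ θ : Decision n dx dy dg, IsSelectedOptimal t X a b α f s θ →
        ∀ γmax : ℝ, IsLUB ((fun z : (Fin n → ℝ) × ℝ => gammaVal θ z.1 z.2) '' (X ×ˢ Icc a b)) γmax →
        ∀ fhat : (Fin n → ℝ) → ℝ, IsArgminSelection X a b θ fhat →
          1 - ε < P.real {x ∈ X | |fhat x - f x| ≤ Real.sqrt (γmax / α)} := by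
  rcases hab.eq_or_lt with rfl | hab'
  -- For `a = b`, where Markov–Lukács is not available, `fhat` and `f` both equal `a` on `X`.
  · refine ⟨univ, MeasurableSet.univ, by simpa using hδ.1.le, fun s _ θ _ γmax _ fhat hfhat => ?_⟩
    have hset : {x ∈ X | |fhat x - f x| ≤ Real.sqrt (γmax / α)} = X := by
      refine sep_eq_self_iff_mem_true.2 fun x hx => ?_
      have h1 := (hfhat.2 x hx).1
      have h2 := hfX x hx
      rw [Icc_self, mem_singleton_iff] at h1 h2
      simp [h1, h2]
    rw [hset, measureReal_def, (mem_ae_iff_prob_eq_one hX).1 hP]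
    simpa using hε.1
  -- Coordinates transport the program to a Euclidean space, whose norm the regularization uses; the
  -- dimension is `n_θ`.
  let Φ : EuclideanSpace ℝ (Fin (numVars n dx dy dg)) ≃ₗ[ℝ] Decision n dx dy dg :=
    LinearEquiv.ofFinrankEq _ _ (finrank_euclideanSpace_fin)
  let c : EuclideanSpace ℝ (Fin (numVars n dx dy dg)) →L[ℝ] ℝ :=
    LinearMap.toContinuousLinearMap (objectiveLinear X a b hint ∘ₗ Φ.toLinearMap)
  have hc : ∀ u, c u = objective X a b (Φ u) := fun u => rfl
  have hfr : Module.finrank ℝ (EuclideanSpace ℝ (Fin (numVars n dx dy dg))) =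
      numVars n dx dy dg := by simp
  have htΦ : ConvexOn ℝ univ fun u => t (Φ u) := ht.comp_linearMap Φ.toLinearMap
  obtain ⟨G, hGm, hGP, hG⟩ := exists_measurableSet_violation_lt (P := P)
    (g := fun u x => minSlack a b α f (Φ u) x) (e := Φ.symm constDecision)
    (hfr.symm ▸ one_le_numVars) c htΦ
    (fun x => ⟨convex_univ, fun u _ u' _ r r' hr hr' hrr => by
      simpa using minSlack_concave (α := α) (f := f) hab (θ := Φ u) (θ' := Φ u') hr hr' hrr x⟩)
    (fun u => measurable_minSlack hf (Φ u))
    (by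
      obtain ⟨θ, hθ⟩ := exists_minSlack_nonneg (dx := dx) (dy := dy) (dg := dg) (f := f) hab hα.le
      exact ⟨Φ.symm θ, by simpa using hθ⟩)
    (fun r _ u x => by
      simpa using minSlack_add_const (α := α) (f := f) hab (Φ u) r x)
    N hε
  have hXm : MeasurableSet {s : Fin N → Fin n → ℝ | ∀ i, s i ∈ X} := by
    simp only [ofPred_forall]
    exact MeasurableSet.iInter fun i => measurable_pi_apply i hX
  have hXae : {s : Fin N → Fin n → ℝ | ∀ i, s i ∈ X} ∈ ae (Measure.pi fun _ : Fin N => P) :=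
    ae_all_iff.2 fun i => Measure.tendsto_eval_ae_ae.eventually hP
  refine ⟨G ∩ {s | ∀ i, s i ∈ X}, hGm.inter hXm, ?_, ?_⟩
  · rw [measureReal_def, measure_inter_conull (mem_ae_iff.1 hXae), ← measureReal_def]
    rw [hfr] at hGP
    linarith
  rintro s ⟨hsG, hsX⟩ θ ⟨⟨hθf, hθo⟩, hθt⟩ γmax hγ fhat hfhat
  have hsf : ∀ i, f (s i) ∈ Icc a b := fun i => hfX _ (hsX i)
  have hmem : ∀ u, u ∈ feasibleSet (fun u x => minSlack a b α f (Φ u) x) s univ ↔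
      Feasible a b α f s (Φ u) := fun u => by
    rw [feasible_iff hab' hsf]
    simp [feasibleSet]
  have hviol := hG s hsG (Φ.symm θ) ⟨(hmem _).2 (by simpa using hθf), fun u hu => by
      simpa [hc] using hθo _ ((hmem u).1 hu), fun u hu hcu hne => by
      have hu' := (hmem u).1 hu
      rw [hc, hc, Φ.apply_symm_apply] at hcu
      change t (Φ (Φ.symm θ)) < t (Φ u)
      rw [Φ.apply_symm_apply]
      refine hθt (Φ u) ⟨hu', fun θ' h' => hcu ▸ hθo θ' h'⟩ fun h => hne ?_
      rw [← h, Φ.symm_apply_apply]⟩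
  simp only [Φ.apply_symm_apply] at hviol
  have hVm : MeasurableSet {x | minSlack a b α f θ x < 0} :=
    measurableSet_lt (measurable_minSlack hf θ) measurable_const
  have hle : P.real {x | minSlack a b α f θ x < 0}ᶜ ≤
      P.real {x ∈ X | |fhat x - f x| ≤ Real.sqrt (γmax / α)} := by
    refine ENNReal.toReal_mono (measure_ne_top _ _) (measure_mono_ae ?_)
    filter_upwards [hP] with x hx hxV
    exact ⟨hx, abs_sub_le_sqrt_of_minSlack_nonneg hab hα hγ.1 hfhat hx (hfX x hx)
      (not_lt.1 hxV)⟩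
  rw [probReal_compl_eq_one_sub hVm] at hle
  linarith

end Application

end PolyArgmin

theorem theorem2
    (n dx dy dg N : ℕ) (a b α ε δ : ℝ) (hab : a ≤ b) (hα : 0 < α)
    (hε : ε ∈ Set.Ioo (0 : ℝ) 1) (hδ : δ ∈ Set.Ioo (0 : ℝ) 1)
    -- the domain; polynomials of degree at most `dg` are integrable on `X × [a, b]`
    (X : Set (Fin n → ℝ)) (hX : MeasurableSet X)
    (hint : ∀ g ∈ MvPolynomial.restrictTotalDegree (Fin n ⊕ Unit) ℝ dg,
      MeasureTheory.IntegrableOn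
        (fun z : (Fin n → ℝ) × ℝ => PolyArgmin.evalXY g z.1 z.2) (X ×ˢ Set.Icc a b))
    -- the unknown function
    (f : (Fin n → ℝ) → ℝ) (hf : Measurable f) (hfX : ∀ x ∈ X, f x ∈ Set.Icc a b)
    -- the distribution of the sample points, carried by `X`
    (P : MeasureTheory.Measure (Fin n → ℝ)) [MeasureTheory.IsProbabilityMeasure P]
    (hP : ∀ᵐ x ∂P, x ∈ X)
    -- the tie-break function
    (t : PolyArgmin.Decision n dx dy dg → ℝ) (ht : ConvexOn ℝ Set.univ t) :
    (PolyArgmin.ExplicitCondition (PolyArgmin.numVars n dx dy dg) N ε δ →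
      PolyArgmin.BinomialCondition (PolyArgmin.numVars n dx dy dg) N ε δ) ∧
    (PolyArgmin.BinomialCondition (PolyArgmin.numVars n dx dy dg) N ε δ ∨
        PolyArgmin.ExplicitCondition (PolyArgmin.numVars n dx dy dg) N ε δ →
      ∃ G : Set (Fin N → Fin n → ℝ), MeasurableSet G ∧
        1 - δ ≤ (MeasureTheory.Measure.pi (fun _ : Fin N => P)).real G ∧
        ∀ s ∈ G, ∀ θ : PolyArgmin.Decision n dx dy dg,
          PolyArgmin.IsSelectedOptimal t X a b α f s θ →
          ∀ γmax : ℝ,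
            IsLUB ((fun z : (Fin n → ℝ) × ℝ => PolyArgmin.gammaVal θ z.1 z.2) ''
              (X ×ˢ Set.Icc a b)) γmax →
          ∀ fhat : (Fin n → ℝ) → ℝ, PolyArgmin.IsArgminSelection X a b θ fhat →
            1 - ε < P.real {x ∈ X | |fhat x - f x| ≤ Real.sqrt (γmax / α)}) := by
  have hexpl := PolyArgmin.binomialCondition_of_explicitCondition (N := N)
    (PolyArgmin.one_le_numVars (n := n) (dx := dx) (dy := dy) (dg := dg)) hε hδ
  exact ⟨hexpl, fun hcond => PolyArgmin.exists_measurableSet_abs_sub_le hab hα hε hδ hX hint hf hfX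
    P hP ht (hcond.elim id hexpl)⟩
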